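/- Let $N\ge 2$. Alice receives $x\in\{1,\dots,N\}$, Bob receives a pair $(y,z)$ with $1\le y<z\le N$, and Bob outputs $b\in\{-1,1\}$; a behaviour is a list of conditional probabilities $P(b|xyz)$, and $\langle P,G\rangle=\sum_{x}\sum_{y<z}\sum_b P(b|xyz)G(b|xyz)$. Let $\mathcal C_2$ be the convex hull of the deterministic behaviours $P(b|xyz)=\delta_{b,g(f(x),y,z)}$ with functions $f:\{1,\dots,N\}\to\{1,2\}$ and $g$ with values in $\{-1,1\}$. Let $\mathcal Q_2$ be the convex hull of the behaviours $P(b|xyz)=\mathrm{tr}(\rho_x\Pi_b^{yz})$, where the $\rho_x$ are density matrices on a common finite-dimensional Hilbert space with $\dim\sum_x\mathrm{supp}\,\rho_x\le 2$ and $\Pi_b^{yz}\ge 0$, $\sum_b\Pi_b^{yz}=\mathbb 1$ for all $y<z$. Consider the witness $$G(b=\pm1|xyz)=\frac{2}{N\sqrt{N-1}}\left(\frac12\mp\sin\left[\frac{\pi}{N}(2x-y-z)\right]\right)$$ and the behaviour $$P^*(b=\pm1|xyz)=\frac12\left(1\mp\sin\left[\frac{\pi}{N}(2x-y-z)\right]\right).$$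 (1) $P^*\in\mathcal Q_2$; it is the behaviour obtained when Alice sends the qubit state $|\psi_x\rangle=\frac{1}{\sqrt2}\sum_{k=0}^{1}e^{2\pi i kx/N}|k\rangle$ and Bob performs on input $(y,z)$ the Helstrom measurement, that is, the measurement that discriminates optimally between the equally likely states $|\psi_y\rangle$ (outcome $+1$) and $|\psi_z\rangle$ (outcome $-1$). (2) If $N\ge 3$, then $\langle P,G\rangle\le B_Q=N\sqrt{N-1}$ for all $P\in\mathcal Q_2$, with equality for $P=P^*$. (3) If $N$ is even, then for all $P\in\mathcal C_2$ $$\langle P,G\rangle\le B_C=\frac{2}{N\sqrt{N-1}}\left(\frac{N^2(N-1)}{4}+\frac{2}{\sin(\pi/N)}\sum_{1\le y<z\le N}\left|\cos\left[\frac{\pi}{N}(1+y+z)\right]\right|\right),$$ with equality attained by a deterministic behaviour. If moreover $N\ge 4$, then $B_C<B_Q$. -/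

import Mathlib

open scoped Matrix ComplexOrder

noncomputable section

namespace PrepareMeasure

/-- The pairing `⟨P, G⟩ = ∑ P(b|xy) G(b|xy)`; `P x y b` stands for `P(b|xy)`. -/
def pairing {X Y B : Type*} [Fintype X] [Fintype Y] [Fintype B]
    (P G : X → Y → B → ℝ) : ℝ :=
  ∑ x, ∑ y, ∑ b, P x y b * G x y b

/-- Deterministic behaviours with a classical message in `[d]`: Alice sends `f x`, Bob answers
`g m y` on the message `m`. -/
def deterministicBehaviours (X Y B : Type*) [DecidableEq B] (d : ℕ) : Set (X → Y → B → ℝ) :=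
  {P | ∃ (f : X → Fin d) (g : Fin d → Y → B),
    ∀ x y b, P x y b = if b = g (f x) y then 1 else 0}

/-- The set `C_d`: classical messages of dimension `d`, with shared randomness. -/
def classicalSet (X Y B : Type*) [DecidableEq B] (d : ℕ) : Set (X → Y → B → ℝ) :=
  convexHull ℝ (deterministicBehaviours X Y B d)

/-- Density matrices. -/
def IsState {n : ℕ} (ρ : Matrix (Fin n) (Fin n) ℂ) : Prop :=
  ρ.PosSemidef ∧ ρ.trace = 1

/-- Quantum measurements (POVMs) with outcomes in `B`. -/
def IsMeasurement {n : ℕ} {B : Type*} [Fintype B] (M : B → Matrix (Fin n) (Fin n) ℂ) : Prop :=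
  (∀ b, (M b).PosSemidef) ∧ ∑ b, M b = 1

/-- `P(b|xy) = tr (ρ_x Π_b^y)`. -/
def IsBornBehaviour {n : ℕ} {X Y B : Type*} (ρ : X → Matrix (Fin n) (Fin n) ℂ)
    (M : Y → B → Matrix (Fin n) (Fin n) ℂ) (P : X → Y → B → ℝ) : Prop :=
  ∀ x y b, (P x y b : ℂ) = (ρ x * M y b).trace

/-- The dimension of the sum of the supports of the `ρ_x`
(the support of a Hermitian matrix is its range). -/
def messageDim {n : ℕ} {X : Type*} (ρ : X → Matrix (Fin n) (Fin n) ℂ) : ℕ :=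
  Module.finrank ℂ ↥(⨆ x, LinearMap.range (ρ x).mulVecLin)

/-- Behaviours obtained from quantum messages of dimension at most `d`, without shared
randomness. -/
def quantumBehaviours (X Y B : Type*) [Fintype B] (d : ℕ) : Set (X → Y → B → ℝ) :=
  {P | ∃ (n : ℕ) (ρ : X → Matrix (Fin n) (Fin n) ℂ) (M : Y → B → Matrix (Fin n) (Fin n) ℂ),
    (∀ x, IsState (ρ x)) ∧ messageDim ρ ≤ d ∧ (∀ y, IsMeasurement (M y)) ∧
      IsBornBehaviour ρ M P}

/-- The set `Q_d`: quantum messages of dimension at most `d`, with shared randomness. -/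
def quantumSet (X Y B : Type*) [Fintype B] (d : ℕ) : Set (X → Y → B → ℝ) :=
  convexHull ℝ (quantumBehaviours X Y B d)

/-! State discrimination with `N` inputs. The outputs `b = ±1` are the elements of `ℤˣ`. -/

/-- Alice's inputs `x ∈ {1, …, N}`. -/
abbrev Input (N : ℕ) : Type := {x : ℕ // x ∈ Finset.Icc 1 N}

/-- Bob's inputs `(y, z)` with `1 ≤ y < z ≤ N`. -/
abbrev InputPair (N : ℕ) : Type := {p : Input N × Input N // p.1 < p.2}

/-- `sin (π (2x - y - z) / N)`. -/
def sinTerm (N : ℕ) (x : Input N) (p : InputPair N) : ℝ :=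
  Real.sin (Real.pi / N * (2 * (x : ℕ) - (p.1.1 : ℕ) - (p.1.2 : ℕ)))

/-- `G(b = ±1 | xyz) = 2 / (N √(N-1)) * (1/2 ∓ sin (π (2x - y - z) / N))`. -/
def witness (N : ℕ) : Input N → InputPair N → ℤˣ → ℝ := fun x p b =>
  2 / (N * √((N : ℝ) - 1)) * (1 / 2 - ((b : ℤ) : ℝ) * sinTerm N x p)

/-- `P(b = ±1 | xyz) = (1/2) * (1 ∓ sin (π (2x - y - z) / N))`. -/
def qubitBehaviour (N : ℕ) : Input N → InputPair N → ℤˣ → ℝ := fun x p b =>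
  1 / 2 * (1 - ((b : ℤ) : ℝ) * sinTerm N x p)

/-- The quantum bound `B_Q = N √(N-1)`. -/
def boundQ (N : ℕ) : ℝ := N * √((N : ℝ) - 1)

/-- The classical bound `B_C`. -/
def boundC (N : ℕ) : ℝ :=
  2 / (N * √((N : ℝ) - 1)) *
    ((N : ℝ) ^ 2 * ((N : ℝ) - 1) / 4 +
      2 / Real.sin (Real.pi / N) *
        ∑ p : InputPair N, |Real.cos (Real.pi / N * (1 + (p.1.1 : ℕ) + (p.1.2 : ℕ)))|)

/-- The vector `ψ_x = (1/√2) ∑_{k=0,1} exp (2πi k x / N) |k⟩`. -/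
def qubitVector (N : ℕ) (x : Input N) : Fin 2 → ℂ := fun k =>
  1 / (√2 : ℝ) * Complex.exp (Complex.I * (2 * Real.pi * (k : ℕ) * (x : ℕ) / N))

/-- The pure state `|ψ_x⟩⟨ψ_x|`. -/
def qubitState (N : ℕ) (x : Input N) : Matrix (Fin 2) (Fin 2) ℂ :=
  Matrix.vecMulVec (qubitVector N x) (star (qubitVector N x))

/-- Probability of identifying correctly which of the equally likely states `σ` (outcome `1`) and
`τ` (outcome `-1`) was prepared. -/
def discriminationProb {n : ℕ} (σ τ : Matrix (Fin n) (Fin n) ℂ)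
    (M : ℤˣ → Matrix (Fin n) (Fin n) ℂ) : ℝ :=
  1 / 2 * (σ * M 1).trace.re + 1 / 2 * (τ * M (-1)).trace.re

/-- Helstrom measurements: those that discriminate optimally between `σ` and `τ`. -/
def IsHelstrom {n : ℕ} (σ τ : Matrix (Fin n) (Fin n) ℂ)
    (M : ℤˣ → Matrix (Fin n) (Fin n) ℂ) : Prop :=
  IsMeasurement M ∧ ∀ M' : ℤˣ → Matrix (Fin n) (Fin n) ℂ, IsMeasurement M' →
    discriminationProb σ τ M' ≤ discriminationProb σ τ M

end PrepareMeasure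

end

/-! On normalized behaviours the witness is, up to a positive factor, the constant `N²(N-1)/4` plus
the correlation `∑ s(x,p) (P(-1) - P(1))`, where `s` is the sine kernel (`pairing_witness_eq`). The
pairing is linear, so each upper bound only has to be checked on the behaviours generating the
convex hull.

Quantum: compression to the sum of the supports (`exists_compression`) leaves matrices of size at
most 2. Since `∑ x, s(x,p) = 0`, each `ρ_x` may be replaced by `ρ_x - 1/2`, of squared
Hilbert-Schmidt norm at most 1/2, while `Π_{-1} - Π_1` has squared norm at most 2. The kernel lives
on the two first Fourier modes in `x`, and for `N ≥ 3` both have the same singular value; a weighted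
AM-GM inequality applied to each real coordinate of the matrices (`sum_sinTerm_mul_mul_le`) then
bounds the correlation by `N²(N-1)/4`.

Helstrom: between equatorial qubit states only one off-diagonal component of the effect matters.
Positivity bounds it by 1/2, and attaining this bound fixes the statistics on the whole equator, so
every Helstrom measurement gives `P*`.

Classical: a message bit splits the inputs into `S` and its complement, and Bob's best signs give `2
∑ p, |∑ x ∈ S, s(x,p)|`. For fixed signs the inner objective is a single sinusoid in `x`, so a half
circle is an optimal `S`; all half circles give the same bound because pairs can be shifted
cyclically (`sum_abs_sum_sinTerm_le`). The gap to `B_Q` follows from concavity of sine and from `√2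
|c| ≤ c² + 1/2`, averaged over pairs. -/

namespace PrepareMeasure

open Finset

/-! ### Trigonometric sums over inputs and pairs, and the norm of the sine kernel. -/

section Trigonometry

/-- Telescoping evaluation of a sum of sines in arithmetic progression. -/
lemma two_mul_sin_mul_sum_sin (δ β : ℝ) (n : ℕ) :
    2 * Real.sin δ * ∑ i ∈ range n, Real.sin (2 * δ * i + β) =
      Real.cos (β - δ) - Real.cos (β - δ + 2 * δ * n) := by
  have h : ∀ i : ℕ, 2 * Real.sin δ * Real.sin (2 * δ * i + β) =
      Real.cos (β - δ + 2 * δ * i) - Real.cos (β - δ + 2 * δ * (i + 1 : ℕ)) := by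
    intro i
    rw [Real.cos_sub_cos]
    have e1 : (β - δ + 2 * δ * i + (β - δ + 2 * δ * (i + 1 : ℕ))) / 2 = 2 * δ * i + β := by
      push_cast; ring
    have e2 : (β - δ + 2 * δ * i - (β - δ + 2 * δ * (i + 1 : ℕ))) / 2 = -δ := by
      push_cast; ring
    rw [e1, e2, Real.sin_neg]; ring
  rw [mul_sum, sum_congr rfl fun i _ => h i,
    sum_range_sub' (fun i : ℕ => Real.cos (β - δ + 2 * δ * i))]
  simp

/-- Sums of a periodic function over a full period are shift invariant. -/
lemma sum_range_add_int_of_periodic {N : ℕ} {h : ℤ → ℝ} (hh : ∀ k, h (k + N) = h k) (j : ℤ) :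
    ∑ i ∈ range N, h (i + j) = ∑ i ∈ range N, h i := by
  have step : ∀ j : ℤ, ∑ i ∈ range N, h (i + (j + 1)) = ∑ i ∈ range N, h (i + j) := by
    intro j
    have h1 := sum_range_succ' (fun i : ℕ => h (i + j)) N
    rw [sum_range_succ] at h1
    have h2 := hh j
    rw [add_comm j] at h2
    have h3 : ∀ i : ℕ, h ((i : ℤ) + (j + 1)) = h (((i + 1 : ℕ) : ℤ) + j) := by
      intro i; congr 1; push_cast; ring
    simp only [h3]
    simp only [Nat.cast_zero, zero_add] at h1
    linarith
  induction j using Int.induction_on with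
  | zero => simp
  | succ i ih => rw [step, ih]
  | pred i ih => rw [← ih, ← step (-(i : ℤ) - 1)]; simp

lemma sum_input_eq (N : ℕ) (h : ℕ → ℝ) : ∑ x : Input N, h x = ∑ i ∈ range N, h (i + 1) := by
  rw [show (∑ x : Input N, h x) = ∑ x ∈ Icc 1 N, h x from sum_coe_sort (Icc 1 N) h]
  rw [range_eq_Ico, sum_Ico_add' h 0 N 1]
  rfl

lemma sum_input_add_int {N : ℕ} {h : ℤ → ℝ} (hh : ∀ k, h (k + N) = h k) (j : ℤ) :
    ∑ x : Input N, h ((x : ℕ) + j) = ∑ i ∈ range N, h i := by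
  rw [sum_input_eq N (fun k => h (k + j)), ← sum_range_add_int_of_periodic hh (1 + j)]
  refine sum_congr rfl fun i _ => ?_
  congr 1; push_cast; ring

lemma card_input (N : ℕ) : Fintype.card (Input N) = N := by simp

/-- A sum over pairs `y < z` of a symmetric function. -/
lemma two_mul_sum_pairs {N : ℕ} (H : Input N → Input N → ℝ) (hH : ∀ y z, H y z = H z y) :
    2 * ∑ p : InputPair N, H p.1.1 p.1.2 = ∑ y, ∑ z, H y z - ∑ y, H y y := by
  have h1 : ∑ p : InputPair N, H p.1.1 p.1.2 = ∑ y, ∑ z, if y < z then H y z else 0 := by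
    rw [← Fintype.sum_prod_type' (f := fun y z : Input N => if y < z then H y z else 0),
      ← sum_filter, sum_subtype (p := fun q : Input N × Input N => q.1 < q.2)]
    simp
  have h2 : ∑ y, ∑ z, (if z < y then H y z else 0) = ∑ y, ∑ z, if y < z then H y z else 0 := by
    rw [sum_comm]
    exact sum_congr rfl fun y _ => sum_congr rfl fun z _ => by rw [hH]
  have h3 : ∑ y, H y y = ∑ y, ∑ z, if y = z then H y z else 0 := by simp
  have h4 : ∑ y, ∑ z, H y z = ∑ y, ∑ z, ((if y < z then H y z else 0) +
      (if z < y then H y z else 0) + if y = z then H y z else 0) := by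
    refine sum_congr rfl fun y _ => sum_congr rfl fun z _ => ?_
    rcases lt_trichotomy y z with h | h | h
    · simp [h, h.not_gt, h.ne]
    · simp [h]
    · simp [h, h.not_gt, h.ne']
  rw [h4, h3]
  simp only [sum_add_distrib]
  rw [h2, h1]; ring

lemma two_mul_card_pairs (N : ℕ) : 2 * (Fintype.card (InputPair N) : ℝ) = N * (N - 1) := by
  have h := two_mul_sum_pairs (N := N) (fun _ _ => 1) (fun _ _ => rfl)
  simp only [sum_const, card_univ, card_input, nsmul_eq_mul, mul_one] at h
  rw [h]; ring

variable {N : ℕ}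

/-- The telescoped cosines differ by the angle `2δN`, a multiple of `2π`, so they cancel. -/
lemma sum_input_sin_of_sin_ne_zero {δ : ℝ} (j : ℕ) (hδ : Real.sin δ ≠ 0) (hN : δ * N = j * Real.pi)
    (β : ℝ) : ∑ x : Input N, Real.sin (2 * δ * (x : ℕ) + β) = 0 := by
  rw [sum_input_eq N (fun k => Real.sin (2 * δ * k + β))]
  have h := two_mul_sin_mul_sum_sin δ (β + 2 * δ) N
  have e : 2 * δ * N = j * (2 * Real.pi) := by linarith
  rw [e, Real.cos_add_nat_mul_two_pi, sub_self] at h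
  have h2 : ∑ i ∈ range N, Real.sin (2 * δ * ((i + 1 : ℕ) : ℝ) + β) =
      ∑ i ∈ range N, Real.sin (2 * δ * i + (β + 2 * δ)) :=
    sum_congr rfl fun i _ => by congr 1; push_cast; ring
  rw [h2]
  rcases mul_eq_zero.1 h with h | h
  · exact absurd (by linarith) hδ
  · exact h

lemma sin_pi_div_pos (hN : 2 ≤ N) : 0 < Real.sin (Real.pi / N) := by
  have : (2 : ℝ) ≤ N := by exact_mod_cast hN
  refine Real.sin_pos_of_pos_of_lt_pi (by positivity) ?_
  rw [div_lt_iff₀ (by linarith)]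
  nlinarith [Real.pi_pos]

lemma sum_input_sin (hN : 2 ≤ N) (β : ℝ) :
    ∑ x : Input N, Real.sin (2 * (Real.pi / N) * (x : ℕ) + β) = 0 := by
  have : (2 : ℝ) ≤ N := by exact_mod_cast hN
  refine sum_input_sin_of_sin_ne_zero 1 (sin_pi_div_pos hN).ne' ?_ β
  field_simp
  simp

/-- This is where `N ≥ 3` enters: for `N = 2` the second harmonic is constant on the integers. -/
lemma sum_input_sin_four (hN : 3 ≤ N) (β : ℝ) :
    ∑ x : Input N, Real.sin (4 * (Real.pi / N) * (x : ℕ) + β) = 0 := by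
  have h3 : (3 : ℝ) ≤ N := by exact_mod_cast hN
  have hs : 0 < Real.sin (2 * (Real.pi / N)) := by
    refine Real.sin_pos_of_pos_of_lt_pi (by positivity) ?_
    rw [← mul_div_assoc, div_lt_iff₀ (by linarith)]
    nlinarith [Real.pi_pos]
  rw [← sum_input_sin_of_sin_ne_zero (N := N) 2 hs.ne' ?_ β]
  · exact sum_congr rfl fun x _ => by congr 1; ring
  · field_simp
    simp

lemma sum_input_cos_four (hN : 3 ≤ N) (β : ℝ) :
    ∑ x : Input N, Real.cos (4 * (Real.pi / N) * (x : ℕ) + β) = 0 := by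
  rw [← sum_input_sin_four hN (β + Real.pi / 2)]
  refine sum_congr rfl fun x _ => ?_
  rw [← add_assoc, Real.sin_add_pi_div_two]

/-- The sum over all `(y, z)` vanishes row by row, and the diagonal to be removed is a second
harmonic. -/
lemma sum_pairs_sin (hN : 3 ≤ N) (β : ℝ) :
    ∑ p : InputPair N, Real.sin (2 * (Real.pi / N) * ((p.1.1 : ℕ) + (p.1.2 : ℕ)) + β) = 0 := by
  have h := two_mul_sum_pairs (N := N)
    (fun y z => Real.sin (2 * (Real.pi / N) * ((y : ℕ) + (z : ℕ)) + β))
    (fun y z => by rw [add_comm ((y : ℕ) : ℝ)])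
  have h1 : ∀ y : Input N, ∑ z : Input N,
      Real.sin (2 * (Real.pi / N) * ((y : ℕ) + (z : ℕ)) + β) = 0 := by
    intro y
    rw [← sum_input_sin (by omega : 2 ≤ N) (2 * (Real.pi / N) * (y : ℕ) + β)]
    exact sum_congr rfl fun z _ => by congr 1; ring
  have h2 : ∑ y : Input N, Real.sin (2 * (Real.pi / N) * ((y : ℕ) + (y : ℕ)) + β) = 0 := by
    rw [← sum_input_sin_four hN β]
    exact sum_congr rfl fun z _ => by congr 1; ring
  simp only [h1, h2, sum_const_zero] at h
  linarith

lemma sum_pairs_cos (hN : 3 ≤ N) (β : ℝ) :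
    ∑ p : InputPair N, Real.cos (2 * (Real.pi / N) * ((p.1.1 : ℕ) + (p.1.2 : ℕ)) + β) = 0 := by
  rw [← sum_pairs_sin hN (β + Real.pi / 2)]
  refine sum_congr rfl fun x _ => ?_
  rw [← add_assoc, Real.sin_add_pi_div_two]

lemma sinTerm_eq (x : Input N) (p : InputPair N) : sinTerm N x p =
    Real.sin (2 * (Real.pi / N) * (x : ℕ) + -(Real.pi / N * ((p.1.1 : ℕ) + (p.1.2 : ℕ)))) := by
  unfold sinTerm; congr 1; ring

lemma sum_input_sinTerm (hN : 2 ≤ N) (p : InputPair N) : ∑ x, sinTerm N x p = 0 := by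
  simp only [sinTerm_eq]
  exact sum_input_sin hN _

lemma sum_input_sinTerm_sq (hN : 3 ≤ N) (p : InputPair N) :
    ∑ x, sinTerm N x p ^ 2 = N / 2 := by
  have h : ∀ x : Input N, sinTerm N x p ^ 2 = 1 / 2 - 1 / 2 *
      Real.cos (4 * (Real.pi / N) * (x : ℕ) +
        -(2 * (Real.pi / N) * ((p.1.1 : ℕ) + (p.1.2 : ℕ)))) := by
    intro x
    rw [sinTerm_eq, Real.sin_sq_eq_half_sub]
    have : ∀ a b : ℝ, a = b → 1 / 2 - Real.cos a / 2 = 1 / 2 - 1 / 2 * Real.cos b := by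
      rintro a b rfl; ring
    apply this; ring
  simp only [h]
  rw [sum_sub_distrib, ← mul_sum, sum_input_cos_four hN]
  simp only [sum_const, card_univ, card_input, nsmul_eq_mul]
  ring

/-- Bessel's inequality for the two first Fourier modes. -/
lemma sq_sum_sin_add_sq_sum_cos_le (hN : 3 ≤ N) (r : Input N → ℝ) :
    (∑ x : Input N, Real.sin (2 * (Real.pi / N) * (x : ℕ)) * r x) ^ 2 +
      (∑ x : Input N, Real.cos (2 * (Real.pi / N) * (x : ℕ)) * r x) ^ 2 ≤ N / 2 * ∑ x, r x ^ 2 := by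
  have h3 : (3 : ℝ) ≤ N := by exact_mod_cast hN
  set s : Input N → ℝ := fun x => Real.sin (2 * (Real.pi / N) * (x : ℕ)) with hs
  set c : Input N → ℝ := fun x => Real.cos (2 * (Real.pi / N) * (x : ℕ)) with hc
  have hc4 := sum_input_cos_four hN 0
  have hs4 := sum_input_sin_four hN 0
  have dbl : ∀ x : Input N, 4 * (Real.pi / N) * (x : ℕ) + 0 =
    2 * (2 * (Real.pi / N) * (x : ℕ)) := fun x => by ring
  simp only [dbl, Real.cos_two_mul, Real.sin_two_mul] at hc4 hs4
  have one : ∑ _x : Input N, (1 : ℝ) = N := by simp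
  have hcc : ∑ x, c x ^ 2 = N / 2 := by
    rw [sum_sub_distrib, ← mul_sum, one] at hc4
    change 2 * ∑ x, c x ^ 2 - (N : ℝ) = 0 at hc4
    linarith
  have hss : ∑ x, s x ^ 2 = N / 2 := by
    have : ∀ x, s x ^ 2 = 1 - c x ^ 2 := fun x => Real.sin_sq _
    simp only [this]
    rw [sum_sub_distrib, one, hcc]; ring
  have hsc : ∑ x, s x * c x = 0 := by
    have : ∀ x : Input N, 2 * Real.sin (2 * (Real.pi / N) * (x : ℕ)) *
      Real.cos (2 * (Real.pi / N) * (x : ℕ)) = 2 * (s x * c x) := fun x => by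
        simp only [hs, hc]; ring
    simp only [this] at hs4
    rw [← mul_sum] at hs4
    linarith
  change (∑ x, s x * r x) ^ 2 + (∑ x, c x * r x) ^ 2 ≤ _
  set A := ∑ x, s x * r x with hA
  set B := ∑ x, c x * r x with hB
  -- `s` and `c` are orthogonal with squared norm `N / 2`, so this is `r` minus its projection,
  -- scaled by `N / 2`.
  have key : 0 ≤ ∑ x, (N / 2 * r x - (A * s x + B * c x)) ^ 2 :=
    sum_nonneg fun x _ => sq_nonneg _
  have ex : ∑ x, (N / 2 * r x - (A * s x + B * c x)) ^ 2 =
      (N / 2) ^ 2 * ∑ x, r x ^ 2 - N * A * ∑ x, s x * r x - N * B * ∑ x, c x * r x +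
      A ^ 2 * ∑ x, s x ^ 2 + B ^ 2 * ∑ x, c x ^ 2 + 2 * A * B * ∑ x, s x * c x := by
    simp only [mul_sum, ← sum_add_distrib, ← sum_sub_distrib]
    exact sum_congr rfl fun x _ => by ring
  rw [ex, hcc, hss, hsc, ← hA, ← hB] at key
  have key' : 0 ≤ (N / 2 : ℝ) * (N / 2 * ∑ x, r x ^ 2 - (A ^ 2 + B ^ 2)) := by nlinarith
  have := nonneg_of_mul_nonneg_right key' (by linarith)
  linarith

/-- The sine kernel as a bilinear form: a weighted Hilbert-Schmidt bound. -/
lemma sum_sinTerm_mul_mul_le (hN : 3 ≤ N) (r : Input N → ℝ) (o : InputPair N → ℝ) :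
    ∑ p, ∑ x, sinTerm N x p * (r x * o p) ≤
      (N : ℝ) * (N - 1) / 4 * ∑ x, r x ^ 2 + N / 8 * ∑ p, o p ^ 2 := by
  have h3 : (3 : ℝ) ≤ N := by exact_mod_cast hN
  set A := ∑ x : Input N, Real.sin (2 * (Real.pi / N) * (x : ℕ)) * r x with hA
  set B := ∑ x : Input N, Real.cos (2 * (Real.pi / N) * (x : ℕ)) * r x with hB
  have hAB : A ^ 2 + B ^ 2 ≤ N / 2 * ∑ x, r x ^ 2 := sq_sum_sin_add_sq_sum_cos_le hN r
  set k : InputPair N → ℝ := fun p => ∑ x, sinTerm N x p * r x with hk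
  -- The last two terms oscillate in `y + z` and vanish after summation over pairs, which makes the
  -- two singular values equal.
  have hkp : ∀ p : InputPair N, k p ^ 2 = (A ^ 2 + B ^ 2) / 2 + (A ^ 2 - B ^ 2) / 2 *
      Real.cos (2 * (Real.pi / N) * ((p.1.1 : ℕ) + (p.1.2 : ℕ)) + 0) - A * B *
      Real.sin (2 * (Real.pi / N) * ((p.1.1 : ℕ) + (p.1.2 : ℕ)) + 0) := by
    intro p
    have : k p = Real.cos (Real.pi / N * ((p.1.1 : ℕ) + (p.1.2 : ℕ))) * A -
        Real.sin (Real.pi / N * ((p.1.1 : ℕ) + (p.1.2 : ℕ))) * B := by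
      rw [hk, hA, hB, mul_sum, mul_sum, ← sum_sub_distrib]
      refine sum_congr rfl fun x _ => ?_
      rw [sinTerm_eq, ← sub_eq_add_neg, Real.sin_sub]; ring
    rw [this, add_zero, mul_assoc 2, Real.cos_two_mul, Real.sin_two_mul]
    linear_combination B ^ 2 * Real.sin_sq_add_cos_sq
      (Real.pi / N * ((p.1.1 : ℕ) + (p.1.2 : ℕ)))
  have hksum : ∑ p, k p ^ 2 = (N : ℝ) * (N - 1) / 4 * (A ^ 2 + B ^ 2) := by
    simp only [hkp]
    rw [sum_sub_distrib, sum_add_distrib, ← mul_sum, ← mul_sum, sum_pairs_cos hN,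
      sum_pairs_sin hN]
    simp only [sum_const, card_univ, nsmul_eq_mul]
    linear_combination (A ^ 2 + B ^ 2) / 4 * two_mul_card_pairs N
  -- The weights are chosen so that equality means `k p = N / 4 * o p`, which the optimal qubit
  -- strategy satisfies in each matrix coordinate.
  have hle : ∀ p, ∑ x, sinTerm N x p * (r x * o p) ≤ 2 / N * k p ^ 2 + N / 8 * o p ^ 2 := by
    intro p
    have : ∑ x, sinTerm N x p * (r x * o p) = k p * o p := by
      rw [hk, sum_mul]; exact sum_congr rfl fun x _ => by ring
    rw [this]
    have h := mul_nonneg (by positivity : (0 : ℝ) ≤ 2 / N) (sq_nonneg (k p - N / 4 * o p))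
    have e : 2 / (N : ℝ) * (k p - N / 4 * o p) ^ 2 =
        2 / N * k p ^ 2 + N / 8 * o p ^ 2 - k p * o p := by
      field_simp; ring
    linarith
  refine (sum_le_sum fun p _ => hle p).trans ?_
  rw [sum_add_distrib, ← mul_sum, ← mul_sum, hksum]
  have h := mul_le_mul_of_nonneg_left hAB
    (mul_nonneg (by linarith : (0 : ℝ) ≤ N - 1) (by norm_num : (0 : ℝ) ≤ 1 / 2))
  have e : 2 / (N : ℝ) * (N * (N - 1) / 4 * (A ^ 2 + B ^ 2)) =
      (N - 1) * (1 / 2) * (A ^ 2 + B ^ 2) := by field_simp; ring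
  rw [e]
  nlinarith

end Trigonometry

/-! ### Hilbert-Schmidt bounds and compression to the support. -/

section Quantum

open Matrix

/-- Nonnegativity of the 2×2 principal minor on `i, j`; for `i = j` the minor is zero. -/
lemma posSemidef_normSq_le {n : ℕ} {A : Matrix (Fin n) (Fin n) ℂ} (hA : A.PosSemidef)
    (i j : Fin n) : Complex.normSq (A i j) ≤ (A i i).re * (A j j).re := by
  have hd := (hA.submatrix ![i, j]).det_nonneg
  rw [det_fin_two] at hd
  simp only [submatrix_apply, cons_val_zero, cons_val_one] at hd
  have hi := hA.diag_nonneg (i := i)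
  have hj := hA.diag_nonneg (i := j)
  rw [← hA.isHermitian.apply j i, Complex.star_def, Complex.mul_conj] at hd
  rw [Complex.le_def] at hi hj hd
  have h1 := hd.1
  simp only [Complex.sub_re, Complex.mul_re, Complex.ofReal_re, Complex.zero_re] at h1
  have h2 := hi.2
  simp only [Complex.zero_im] at h2
  rw [← h2] at h1
  linarith

lemma trace_mul_nonneg_of_posSemidef {n : ℕ} {A B : Matrix (Fin n) (Fin n) ℂ}
    (hA : A.PosSemidef) (hB : B.PosSemidef) : 0 ≤ (A * B).trace := by
  obtain ⟨m, v, rfl⟩ := posSemidef_iff_eq_sum_vecMulVec.1 hA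
  rw [Finset.sum_mul, trace_sum]
  refine Finset.sum_nonneg fun i _ => ?_
  rw [trace_mul_comm, mul_vecMulVec, trace_vecMulVec, dotProduct_comm]
  exact hB.dotProduct_mulVec_nonneg _

/-- Turns the trace into a real inner product of coordinates, so that a scalar bilinear bound
applies to each coordinate. -/
lemma trace_mul_re {n : ℕ} (A : Matrix (Fin n) (Fin n) ℂ) {B : Matrix (Fin n) (Fin n) ℂ}
    (hB : B.IsHermitian) : (A * B).trace.re =
      ∑ i, ∑ j, ((A i j).re * (B i j).re + (A i j).im * (B i j).im) := by
  simp only [trace, diag_apply, mul_apply, Complex.re_sum]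
  refine sum_congr rfl fun i _ => sum_congr rfl fun j _ => ?_
  rw [← hB.apply j i]
  simp [Complex.mul_re]

lemma trace_sq_re_le_one {n : ℕ} {ρ : Matrix (Fin n) (Fin n) ℂ} (h : IsState ρ) :
    (ρ * ρ).trace.re ≤ 1 := by
  have ht : ∑ i, (ρ i i).re = 1 := by
    have := congrArg Complex.re h.2
    simpa [trace] using this
  rw [trace_mul_re ρ h.1.isHermitian]
  calc _ ≤ ∑ i, ∑ j, (ρ i i).re * (ρ j j).re := by
        refine sum_le_sum fun i _ => sum_le_sum fun j _ => ?_
        exact posSemidef_normSq_le h.1 i j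
    _ = 1 := by simp_rw [← mul_sum, ht, mul_one, ht]

/-- Expanding gives `tr ρ² - 1 + n / 4`, and `tr ρ² ≤ 1`. -/
lemma trace_centered_sq_re_le {n : ℕ} (hn : n ≤ 2) {ρ : Matrix (Fin n) (Fin n) ℂ}
    (h : IsState ρ) :
    ((ρ - (1 / 2 : ℂ) • (1 : Matrix (Fin n) (Fin n) ℂ)) *
      (ρ - (1 / 2 : ℂ) • (1 : Matrix (Fin n) (Fin n) ℂ))).trace.re ≤ 1 / 2 := by
  have hn' : (n : ℝ) ≤ 2 := by exact_mod_cast hn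
  have e : (ρ - (1 / 2 : ℂ) • (1 : Matrix (Fin n) (Fin n) ℂ)) *
      (ρ - (1 / 2 : ℂ) • (1 : Matrix (Fin n) (Fin n) ℂ)) =
      ρ * ρ - ρ + (1 / 4 : ℂ) • (1 : Matrix (Fin n) (Fin n) ℂ) := by
    simp only [sub_mul, mul_sub, smul_mul_assoc, mul_smul_comm, one_mul, mul_one]
    module
  rw [e, trace_add, trace_sub, h.2, trace_smul, trace_one]
  have := trace_sq_re_le_one h
  simp
  linarith

/-- From `A + B = 1` follows `(A - B)² = 1 - 4AB`, and `tr AB ≥ 0`. -/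
lemma trace_sub_sq_re_le {n : ℕ} {A B : Matrix (Fin n) (Fin n) ℂ} (hA : A.PosSemidef)
    (hB : B.PosSemidef) (hAB : A + B = 1) : ((A - B) * (A - B)).trace.re ≤ n := by
  have e : (A - B) * (A - B) = 1 - (4 : ℂ) • (A * B) := by
    have : B = 1 - A := by rw [← hAB]; abel
    subst this
    simp only [sub_mul, mul_sub, one_mul, mul_one]
    module
  have h := (Complex.le_def.1 (trace_mul_nonneg_of_posSemidef hA hB)).1
  rw [e, trace_sub, trace_smul, trace_one]
  simp only [Complex.zero_re] at h
  simp
  linarith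

lemma univ_intUnits_sum {M : Type*} [AddCommMonoid M] (f : ℤˣ → M) :
    ∑ b, f b = f 1 + f (-1) := by
  rw [UnitsInt.univ, sum_insert (by decide), sum_singleton]

/-- The correlation bound for states and measurements in dimension at most two. -/
lemma sum_sinTerm_mul_trace_le {N n : ℕ} (hN : 3 ≤ N) (hn : n ≤ 2)
    (ρ : Input N → Matrix (Fin n) (Fin n) ℂ)
    (M : InputPair N → ℤˣ → Matrix (Fin n) (Fin n) ℂ)
    (hρ : ∀ x, IsState (ρ x)) (hM : ∀ p, IsMeasurement (M p)) :
    ∑ p, ∑ x, sinTerm N x p * (ρ x * (M p (-1) - M p 1)).trace.re ≤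
      (N : ℝ) ^ 2 * (N - 1) / 4 := by
  have h3 : (3 : ℝ) ≤ N := by exact_mod_cast hN
  have hn' : (n : ℝ) ≤ 2 := by exact_mod_cast hn
  set O : InputPair N → Matrix (Fin n) (Fin n) ℂ := fun p => M p (-1) - M p 1 with hO
  set R : Input N → Matrix (Fin n) (Fin n) ℂ :=
    fun x => ρ x - (1 / 2 : ℂ) • (1 : Matrix (Fin n) (Fin n) ℂ) with hR
  have hOh : ∀ p, (O p).IsHermitian := fun p =>
    ((hM p).1 _).isHermitian.sub ((hM p).1 _).isHermitian
  have hRh : ∀ x, (R x).IsHermitian := fun x =>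
    (hρ x).1.isHermitian.sub (by
      unfold IsHermitian; rw [conjTranspose_smul, conjTranspose_one]; simp)
  have hR2 : ∀ x, ∑ i, ∑ j, ((R x i j).re ^ 2 + (R x i j).im ^ 2) ≤ 1 / 2 := by
    intro x
    have h := trace_centered_sq_re_le hn (hρ x)
    rw [trace_mul_re _ (hRh x)] at h
    simpa only [pow_two] using h
  have hO2 : ∀ p, ∑ i, ∑ j, ((O p i j).re ^ 2 + (O p i j).im ^ 2) ≤ 2 := by
    intro p
    have hs := (hM p).2
    rw [univ_intUnits_sum, add_comm] at hs
    have h := trace_sub_sq_re_le ((hM p).1 (-1)) ((hM p).1 1) hs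
    rw [trace_mul_re _ (hOh p)] at h
    simp only [pow_two]
    exact h.trans hn'
  -- The subtracted half identity contributes a term independent of `x`, which the kernel
  -- annihilates.
  have hcenter : ∀ p, ∑ x, sinTerm N x p * (ρ x * O p).trace.re =
      ∑ x, sinTerm N x p * (R x * O p).trace.re := by
    intro p
    have : ∀ x, sinTerm N x p * (ρ x * O p).trace.re =
        sinTerm N x p * (R x * O p).trace.re +
          sinTerm N x p * ((1 / 2 : ℂ) * (O p).trace).re := by
      intro x
      rw [hR, sub_mul, trace_sub, smul_mul_assoc, one_mul, trace_smul, smul_eq_mul,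
        Complex.sub_re]
      ring
    simp only [this]
    rw [sum_add_distrib, ← sum_mul, sum_input_sinTerm (by omega), zero_mul, add_zero]
  calc ∑ p, ∑ x, sinTerm N x p * (ρ x * O p).trace.re
      = ∑ i, ∑ j, (∑ p, ∑ x, sinTerm N x p * ((R x i j).re * (O p i j).re) +
          ∑ p, ∑ x, sinTerm N x p * ((R x i j).im * (O p i j).im)) := by
        simp only [hcenter, ← sum_add_distrib, ← mul_add]
        simp only [fun x p => trace_mul_re (R x) (hOh p), mul_sum]
        have sw : ∀ f : Fin n → Fin n → InputPair N → Input N → ℝ,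
            ∑ p, ∑ x, ∑ i, ∑ j, f i j p x = ∑ i, ∑ j, ∑ p, ∑ x, f i j p x := by
          intro f
          simp only [← Fintype.sum_prod_type' (α₁ := Fin n) (α₂ := Fin n)]
          rw [sum_congr rfl fun p _ => sum_comm, sum_comm]
        exact sw fun i j p x => _
    _ ≤ ∑ i, ∑ j, (((N : ℝ) * (N - 1) / 4 * ∑ x, (R x i j).re ^ 2 +
            N / 8 * ∑ p, (O p i j).re ^ 2) +
          ((N : ℝ) * (N - 1) / 4 * ∑ x, (R x i j).im ^ 2 + N / 8 * ∑ p, (O p i j).im ^ 2)) :=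
        sum_le_sum fun i _ => sum_le_sum fun j _ => add_le_add
          (sum_sinTerm_mul_mul_le hN _ _) (sum_sinTerm_mul_mul_le hN _ _)
    _ = (N : ℝ) * (N - 1) / 4 * ∑ x, ∑ i, ∑ j, ((R x i j).re ^ 2 + (R x i j).im ^ 2) +
          N / 8 * ∑ p, ∑ i, ∑ j, ((O p i j).re ^ 2 + (O p i j).im ^ 2) := by
        have swx : ∀ f : Input N → Fin n → Fin n → ℝ,
            ∑ x, ∑ i, ∑ j, f x i j = ∑ i, ∑ j, ∑ x, f x i j := by
          intro f
          rw [sum_comm]; exact sum_congr rfl fun i _ => sum_comm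
        have swp : ∀ f : InputPair N → Fin n → Fin n → ℝ,
            ∑ x, ∑ i, ∑ j, f x i j = ∑ i, ∑ j, ∑ x, f x i j := by
          intro f
          rw [sum_comm]; exact sum_congr rfl fun i _ => sum_comm
        rw [swx, swp, mul_sum, mul_sum, ← sum_add_distrib]
        refine sum_congr rfl fun i _ => ?_
        rw [mul_sum, mul_sum, ← sum_add_distrib]
        refine sum_congr rfl fun j _ => ?_
        rw [sum_add_distrib, sum_add_distrib]; ring
    _ ≤ (N : ℝ) * (N - 1) / 4 * ∑ _x : Input N, 1 / 2 + N / 8 * ∑ _p : InputPair N, 2 := by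
        have : (0 : ℝ) ≤ N * (N - 1) / 4 := by
          have : (0 : ℝ) ≤ N - 1 := by linarith
          positivity
        gcongr with x _ p _
        · exact hR2 x
        · exact hO2 p
    -- States and measurements contribute `N²(N-1)/8` each.
    _ = (N : ℝ) ^ 2 * (N - 1) / 4 := by
        simp only [sum_const, card_univ, card_input, nsmul_eq_mul]
        linear_combination (N : ℝ) / 8 * two_mul_card_pairs N

/-- Behaviours from messages of dimension `d` are realized in dimension at most `d`. -/
lemma exists_compression {n d : ℕ} {X Y B : Type*} [Fintype B]
    {ρ : X → Matrix (Fin n) (Fin n) ℂ} {M : Y → B → Matrix (Fin n) (Fin n) ℂ}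
    (hρ : ∀ x, IsState (ρ x)) (hd : messageDim ρ ≤ d) (hM : ∀ y, IsMeasurement (M y)) :
    ∃ (m : ℕ) (ρ' : X → Matrix (Fin m) (Fin m) ℂ) (M' : Y → B → Matrix (Fin m) (Fin m) ℂ),
      m ≤ d ∧ (∀ x, IsState (ρ' x)) ∧ (∀ y, IsMeasurement (M' y)) ∧
      ∀ x y b, (ρ' x * M' y b).trace = (ρ x * M y b).trace := by
  set S : Submodule ℂ (Fin n → ℂ) := ⨆ x, LinearMap.range (ρ x).mulVecLin with hS
  let e := WithLp.linearEquiv 2 ℂ (Fin n → ℂ)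
  let S' : Submodule ℂ (EuclideanSpace ℂ (Fin n)) := S.comap e.toLinearMap
  have hfin : Module.finrank ℂ S' = messageDim ρ := by
    have : S' = S.map e.symm.toLinearMap := by
      rw [← Submodule.comap_equiv_eq_map_symm]
    rw [this, LinearEquiv.finrank_map_eq]; rfl
  let b := stdOrthonormalBasis ℂ S'
  -- The columns are an orthonormal basis of the sum of the supports, so `V` is an isometry and `V *
  -- Vᴴ` the projection that fixes every `ρ x`.
  let V : Matrix (Fin n) (Fin (Module.finrank ℂ S')) ℂ := fun i k => (b k : EuclideanSpace ℂ (Fin n)) i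
  have hVV : Vᴴ * V = 1 := by
    ext k l
    have h := orthonormal_iff_ite.1 b.orthonormal k l
    rw [Submodule.coe_inner, EuclideanSpace.inner_eq_star_dotProduct] at h
    rw [one_apply, ← h, mul_apply, dotProduct]
    refine sum_congr rfl fun i _ => ?_
    exact mul_comm _ _
  have hfix : ∀ v ∈ S, V *ᵥ (Vᴴ *ᵥ v) = v := by
    intro v hv
    let w : S' := ⟨WithLp.toLp 2 v, hv⟩
    have h := congrArg (Subtype.val) (b.sum_repr' w)
    ext i
    have h2 := congrArg (fun u : EuclideanSpace ℂ (Fin n) => u i) h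
    have hc : ∀ k, inner ℂ (b k) w = (Vᴴ *ᵥ v) k := by
      intro k
      rw [Submodule.coe_inner, EuclideanSpace.inner_eq_star_dotProduct, dotProduct_comm]
      rfl
    simp only [hc] at h2
    rw [Submodule.coe_sum] at h2
    refine Eq.trans ?_ h2
    simp [mulVec, dotProduct, V, mul_comm]
  have hρfix : ∀ x, V * Vᴴ * ρ x = ρ x := by
    intro x
    refine ext_of_mulVec_single fun j => ?_
    rw [← mulVec_mulVec, ← mulVec_mulVec]
    refine hfix _ ?_
    exact Submodule.mem_iSup_of_mem x ⟨_, rfl⟩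
  have hρfix' : ∀ x, ρ x * (V * Vᴴ) = ρ x := by
    intro x
    have := congrArg conjTranspose (hρfix x)
    rwa [conjTranspose_mul, conjTranspose_mul, conjTranspose_conjTranspose,
      (hρ x).1.isHermitian.eq] at this
  refine ⟨_, fun x => Vᴴ * ρ x * V, fun y b => Vᴴ * M y b * V, hfin ▸ hd, ?_, ?_, ?_⟩
  · refine fun x => ⟨(hρ x).1.conjTranspose_mul_mul_same V, ?_⟩
    rw [trace_mul_comm, ← Matrix.mul_assoc, hρfix, (hρ x).2]
  · refine fun y => ⟨fun b => ((hM y).1 b).conjTranspose_mul_mul_same V, ?_⟩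
    change ∑ b, Vᴴ * M y b * V = 1
    rw [← Matrix.sum_mul, ← Matrix.mul_sum, (hM y).2, Matrix.mul_one, hVV]
  · intro x y b
    have : Vᴴ * ρ x * V * (Vᴴ * M y b * V) = Vᴴ * (ρ x * (V * Vᴴ)) * (M y b * V) := by
      simp only [Matrix.mul_assoc]
    rw [this, hρfix', Matrix.mul_assoc, trace_mul_comm]
    have : ρ x * (M y b * V) * Vᴴ = ρ x * (M y b * (V * Vᴴ)) := by simp only [Matrix.mul_assoc]
    rw [this, ← trace_mul_comm, Matrix.mul_assoc, Matrix.mul_assoc, ← Matrix.mul_assoc V,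
      hρfix, trace_mul_comm]

end Quantum

/-! ### The witness in terms of correlators; the quantum bound and its attainment. -/

section Pairing

variable {N : ℕ}

/-- For normalized behaviours the witness only sees the correlators. -/
lemma pairing_witness_eq (P : Input N → InputPair N → ℤˣ → ℝ)
    (hP : ∀ x p, P x p 1 + P x p (-1) = 1) :
    pairing P (witness N) = 2 / (N * √((N : ℝ) - 1)) *
      ((N : ℝ) ^ 2 * ((N : ℝ) - 1) / 4 +
        ∑ p, ∑ x, sinTerm N x p * (P x p (-1) - P x p 1)) := by
  have h : ∀ x p, ∑ b, P x p b * witness N x p b = 2 / (N * √((N : ℝ) - 1)) *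
      (1 / 2 + sinTerm N x p * (P x p (-1) - P x p 1)) := by
    intro x p
    rw [univ_intUnits_sum]
    simp only [witness, Units.val_one, Units.val_neg, Int.cast_neg, Int.cast_one]
    linear_combination (1 / 2) * (2 / (N * √((N : ℝ) - 1))) * hP x p
  unfold pairing
  simp only [h]
  rw [sum_comm]
  simp only [← mul_sum, sum_add_distrib]
  congr 2
  simp only [sum_const, card_univ, card_input, nsmul_eq_mul]
  linear_combination (N : ℝ) / 4 * two_mul_card_pairs N

lemma convex_setOf_pairing_le {X Y B : Type*} [Fintype X] [Fintype Y] [Fintype B]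
    (G : X → Y → B → ℝ) (c : ℝ) : Convex ℝ {P : X → Y → B → ℝ | pairing P G ≤ c} := by
  refine convex_halfSpace_le ⟨fun P Q => ?_, fun a P => ?_⟩ c
  · simp only [pairing, Pi.add_apply, add_mul, sum_add_distrib]
  · simp only [pairing, Pi.smul_apply, smul_eq_mul, mul_sum, mul_assoc]

/-- In this form the constant part of the pairing is half of the bound; the correlation has to
supply the other half. -/
lemma boundQ_eq (hN : 2 ≤ N) : boundQ N =
    2 / (N * √((N : ℝ) - 1)) * ((N : ℝ) ^ 2 * ((N : ℝ) - 1) / 2) := by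
  have h2 : (2 : ℝ) ≤ N := by exact_mod_cast hN
  have hs : 0 < √((N : ℝ) - 1) := Real.sqrt_pos.2 (by linarith)
  have hsq := Real.mul_self_sqrt (by linarith : (0 : ℝ) ≤ N - 1)
  unfold boundQ
  field_simp
  nlinarith

lemma pairing_prefactor_pos (hN : 2 ≤ N) : 0 < 2 / ((N : ℝ) * √((N : ℝ) - 1)) := by
  have h2 : (2 : ℝ) ≤ N := by exact_mod_cast hN
  have hs : 0 < √((N : ℝ) - 1) := Real.sqrt_pos.2 (by linarith)
  positivity

theorem pairing_le_boundQ (hN : 3 ≤ N) (P : Input N → InputPair N → ℤˣ → ℝ)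
    (hP : P ∈ quantumSet (Input N) (InputPair N) ℤˣ 2) : pairing P (witness N) ≤ boundQ N := by
  refine convexHull_min ?_ (convex_setOf_pairing_le (witness N) (boundQ N)) hP
  rintro P ⟨n, ρ, M, hρ, hd, hM, hB⟩
  obtain ⟨m, ρ', M', hm, hρ', hM', htr⟩ := exists_compression hρ hd hM
  have hPre : ∀ x p b, P x p b = (ρ' x * M' p b).trace.re := by
    intro x p b
    rw [htr, ← hB, Complex.ofReal_re]
  have hnorm : ∀ x p, P x p 1 + P x p (-1) = 1 := by
    intro x p
    rw [hPre, hPre, ← Complex.add_re, ← Matrix.trace_add, ← mul_add, ← univ_intUnits_sum,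
      (hM' p).2, mul_one, (hρ' x).2, Complex.one_re]
  have hcorr : ∀ x p, P x p (-1) - P x p 1 = (ρ' x * (M' p (-1) - M' p 1)).trace.re := by
    intro x p
    rw [hPre, hPre, mul_sub, Matrix.trace_sub, Complex.sub_re]
  change pairing P (witness N) ≤ boundQ N
  rw [pairing_witness_eq P hnorm, boundQ_eq (by omega)]
  refine mul_le_mul_of_nonneg_left ?_ (pairing_prefactor_pos (by omega)).le
  simp only [hcorr]
  have := sum_sinTerm_mul_trace_le hN hm ρ' M' hρ' hM'
  linarith

lemma pairing_qubitBehaviour (hN : 3 ≤ N) :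
    pairing (qubitBehaviour N) (witness N) = boundQ N := by
  rw [pairing_witness_eq, boundQ_eq (by omega)]
  · congr 1
    have h : ∀ x p, sinTerm N x p * (qubitBehaviour N x p (-1) - qubitBehaviour N x p 1) =
        sinTerm N x p ^ 2 := by
      intro x p
      simp only [qubitBehaviour, Units.val_one, Units.val_neg, Int.cast_neg, Int.cast_one]
      ring
    simp only [h, sum_input_sinTerm_sq hN, sum_const, card_univ, nsmul_eq_mul]
    linear_combination (N : ℝ) / 4 * two_mul_card_pairs N
  · intro x p
    simp only [qubitBehaviour, Units.val_one, Units.val_neg, Int.cast_neg, Int.cast_one]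
    ring

end Pairing

/-! ### Optimal discrimination of equatorial qubit states. -/

section Helstrom

open Matrix Complex

/-- The pure qubit state on the equator of the Bloch sphere with phase `u`. -/
noncomputable def equatorialState (u : ℂ) : Matrix (Fin 2) (Fin 2) ℂ :=
  !![1 / 2, star u / 2; u / 2, 1 / 2]

lemma equatorialState_one_zero (u : ℂ) : equatorialState u 1 0 = u / 2 := rfl

lemma equatorialState_eq_vecMulVec {u : ℂ} (hu : normSq u = 1) (v : Fin 2 → ℂ)
    (h0 : v 0 = ((1 / √2 : ℝ) : ℂ)) (h1 : v 1 = ((1 / √2 : ℝ) : ℂ) * u) :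
    vecMulVec v (star v) = equatorialState u := by
  have h2 : ((1 / √2 : ℝ) : ℂ) * ((1 / √2 : ℝ) : ℂ) = 1 / 2 := by
    rw [← ofReal_mul, div_mul_div_comm, Real.mul_self_sqrt (by norm_num)]
    norm_num
  have hu' : u * star u = 1 := by
    rw [star_def, mul_conj, hu, ofReal_one]
  have hs : star ((1 / √2 : ℝ) : ℂ) = ((1 / √2 : ℝ) : ℂ) := conj_ofReal _
  ext i j
  fin_cases i <;> fin_cases j <;>
    simp only [equatorialState, vecMulVec_apply, Pi.star_apply, Fin.zero_eta, Fin.mk_one,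
      h0, h1, star_mul', hs, of_apply, cons_val', cons_val_zero, cons_val_one, cons_val_fin_one]
  · exact h2
  · linear_combination star u * h2
  · linear_combination u * h2
  · linear_combination u * star u * h2 + 1 / 2 * hu'

lemma posSemidef_equatorialState {u : ℂ} (hu : normSq u = 1) :
    (equatorialState u).PosSemidef := by
  rw [← equatorialState_eq_vecMulVec hu ![((1 / √2 : ℝ) : ℂ), ((1 / √2 : ℝ) : ℂ) * u] rfl rfl]
  exact posSemidef_vecMulVec_self_star _

lemma isState_equatorialState {u : ℂ} (hu : normSq u = 1) : IsState (equatorialState u) := by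
  refine ⟨posSemidef_equatorialState hu, ?_⟩
  simp [equatorialState, trace_fin_two]
  norm_num

lemma equatorialState_add_neg (u : ℂ) : equatorialState u + equatorialState (-u) = 1 := by
  ext i j
  fin_cases i <;> fin_cases j <;> simp [equatorialState] <;> ring

/-- Equatorial states see only the trace and the off-diagonal entry of an effect; uniqueness of the
Helstrom statistics rests on this. -/
lemma trace_equatorialState_mul (e : ℂ) {A : Matrix (Fin 2) (Fin 2) ℂ} (hA : A.IsHermitian) :
    (equatorialState e * A).trace =
      ((((A 0 0).re + (A 1 1).re) / 2 + (star e * A 1 0).re : ℝ) : ℂ) := by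
  have h0 : (((A 0 0).re : ℝ) : ℂ) = A 0 0 := hA.coe_re_apply_self 0
  have h1 : (((A 1 1).re : ℝ) : ℂ) = A 1 1 := hA.coe_re_apply_self 1
  have h2 : A 0 1 = star (A 1 0) := (hA.apply 0 1).symm
  have h3 : (((star e * A 1 0).re : ℝ) : ℂ) = (star e * A 1 0 + e * star (A 1 0)) / 2 := by
    rw [re_eq_add_conj, map_mul, star_def, conj_conj]
  push_cast
  rw [h0, h1, h3, trace_fin_two, mul_apply, mul_apply, Fin.sum_univ_two, Fin.sum_univ_two, h2]
  simp only [equatorialState, of_apply, cons_val', cons_val_zero, cons_val_one, cons_val_fin_one]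
  ring

variable {M : ℤˣ → Matrix (Fin 2) (Fin 2) ℂ}

lemma IsMeasurement.neg_one_eq (hM : IsMeasurement M) : M (-1) = 1 - M 1 := by
  rw [← hM.2, univ_intUnits_sum]; abel

/-- The off-diagonal entry of a qubit effect has modulus at most `1/2`, and if this is attained
then the effect has trace one. -/
lemma IsMeasurement.four_mul_normSq_le (hM : IsMeasurement M) :
    4 * normSq (M 1 1 0) + ((M 1 0 0).re + (M 1 1 1).re - 1) ^ 2 ≤ 1 := by
  have h1 := posSemidef_normSq_le (hM.1 1) 1 0
  have h2 := posSemidef_normSq_le (hM.1 (-1)) 1 0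
  rw [hM.neg_one_eq] at h2
  simp [Matrix.sub_apply] at h2
  set a := (M 1 0 0).re
  set b := (M 1 1 1).re
  set q := normSq (M 1 1 0)
  have ha : 0 ≤ a := (Complex.le_def.1 (hM.1 1).diag_nonneg).1
  have hb : 0 ≤ b := (Complex.le_def.1 (hM.1 1).diag_nonneg).1
  have ha' := (Complex.le_def.1 ((hM.1 (-1)).diag_nonneg (i := 0))).1
  have hb' := (Complex.le_def.1 ((hM.1 (-1)).diag_nonneg (i := 1))).1
  rw [hM.neg_one_eq] at ha' hb'
  simp [Matrix.sub_apply] at ha' hb'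
  change a ≤ 1 at ha'
  change b ≤ 1 at hb'
  -- Positivity of both effects gives `q ≤ a b` and `q ≤ (1 - a) (1 - b)`; the first suffices when
  -- `a + b ≤ 1`, the second otherwise.
  rcases le_total (a + b) 1 with h | h
  · nlinarith [sq_nonneg (a - b), mul_nonneg (add_nonneg ha hb) (sub_nonneg.2 h)]
  · nlinarith [sq_nonneg (a - b), mul_nonneg (sub_nonneg.2 h) (by linarith : 0 ≤ 2 - (a + b))]

/-- Both states have the same diagonal, so only their off-diagonal difference, in direction `u`, is
visible. -/
lemma IsMeasurement.discriminationProb_eq (hM : IsMeasurement M) {e₁ e₂ u : ℂ} {s : ℝ}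
    (he : e₁ - e₂ = 2 * s * u) :
    discriminationProb (equatorialState e₁) (equatorialState e₂) M =
      1 / 2 + s * (star u * M 1 1 0).re := by
  have hh := (hM.1 1).isHermitian
  have hh' := (hM.1 (-1)).isHermitian
  rw [discriminationProb, trace_equatorialState_mul e₁ hh, trace_equatorialState_mul e₂ hh',
    ofReal_re, ofReal_re, hM.neg_one_eq]
  have hr := congrArg re he
  have hi := congrArg im he
  simp at hr hi
  simp [Matrix.sub_apply]
  linear_combination 1 / 2 * (M 1 1 0).re * hr + 1 / 2 * (M 1 1 0).im * hi

lemma isMeasurement_equatorialState {u : ℂ} (hu : normSq u = 1) :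
    IsMeasurement fun b : ℤˣ => equatorialState (((b : ℤ) : ℂ) * u) := by
  refine ⟨fun b => posSemidef_equatorialState ?_, ?_⟩
  · rcases Int.units_eq_one_or b with rfl | rfl <;> simp [hu]
  · rw [univ_intUnits_sum]
    simpa using equatorialState_add_neg u

lemma isHelstrom_equatorialState {e₁ e₂ u : ℂ} {s : ℝ} (he : e₁ - e₂ = 2 * s * u) (hs : 0 < s)
    (hu : normSq u = 1) : IsHelstrom (equatorialState e₁) (equatorialState e₂)
      fun b : ℤˣ => equatorialState (((b : ℤ) : ℂ) * u) := by
  refine ⟨isMeasurement_equatorialState hu, fun M' hM' => ?_⟩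
  rw [hM'.discriminationProb_eq he, (isMeasurement_equatorialState hu).discriminationProb_eq he]
  have h1 : star u * equatorialState ((((1 : ℤˣ) : ℤ) : ℂ) * u) 1 0 = 1 / 2 := by
    have : star u * u = 1 := by rw [mul_comm, star_def, mul_conj, hu, ofReal_one]
    rw [equatorialState_one_zero, Units.val_one, Int.cast_one]
    linear_combination 1 / 2 * this
  rw [h1]
  have h2 : normSq (star u * M' 1 1 0) ≤ 1 / 4 := by
    rw [map_mul, star_def, normSq_conj, hu, one_mul]
    nlinarith [hM'.four_mul_normSq_le]
  rw [normSq_apply] at h2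
  have h3 : (star u * M' 1 1 0).re ≤ 1 / 2 := by
    by_contra! h
    nlinarith [mul_self_nonneg (star u * M' 1 1 0).im]
  have h4 : (1 / 2 : ℂ).re = 1 / 2 := by norm_num
  rw [h4]
  nlinarith

/-- Helstrom measurements of two distinct equatorial qubit states are unique as far as the
statistics on equatorial states are concerned. -/
lemma IsHelstrom.trace_equatorialState_mul {e₁ e₂ u : ℂ} {s : ℝ} (he : e₁ - e₂ = 2 * s * u)
    (hs : 0 < s) (hu : normSq u = 1)
    (hM : IsHelstrom (equatorialState e₁) (equatorialState e₂) M) (e : ℂ) (b : ℤˣ) :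
    (equatorialState e * M b).trace = ((1 / 2 * (1 + ((b : ℤ) : ℝ) * (star e * u).re) : ℝ) : ℂ) := by
  have hopt := hM.2 _ (isMeasurement_equatorialState hu)
  have huu : star u * u = 1 := by rw [mul_comm, star_def, mul_conj, hu, ofReal_one]
  rw [hM.1.discriminationProb_eq he,
    (isMeasurement_equatorialState hu).discriminationProb_eq he] at hopt
  have h1 : star u * equatorialState ((((1 : ℤˣ) : ℤ) : ℂ) * u) 1 0 = 1 / 2 := by
    rw [equatorialState_one_zero, Units.val_one, Int.cast_one]
    linear_combination 1 / 2 * huu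
  have h4 : (1 / 2 : ℂ).re = 1 / 2 := by norm_num
  rw [h1, h4] at hopt
  have hle := hM.1.four_mul_normSq_le
  have hw : normSq (star u * M 1 1 0) = normSq (M 1 1 0) := by
    rw [map_mul, star_def, normSq_conj, hu, one_mul]
  rw [← hw, normSq_apply] at hle
  set w := star u * M 1 1 0 with hwdef
  -- Comparison with the explicit measurement forces the extreme value, and then `hle` leaves no
  -- room for `w.im` or `d`.
  have hre : 1 / 2 ≤ w.re := by
    have : s * (1 / 2) ≤ s * w.re := by linarith
    exact le_of_mul_le_mul_left this hs
  set d := (M 1 0 0).re + (M 1 1 1).re - 1 with hd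
  have hre' : w.re = 1 / 2 := by nlinarith [sq_nonneg d, mul_self_nonneg w.im]
  rw [hre'] at hle
  have him : w.im = 0 := by
    have : w.im * w.im = 0 := le_antisymm (by nlinarith [sq_nonneg d]) (mul_self_nonneg _)
    exact mul_self_eq_zero.1 this
  have hd0 : d = 0 := by
    have : d ^ 2 = 0 := le_antisymm (by nlinarith [mul_self_nonneg w.im]) (sq_nonneg _)
    exact pow_eq_zero_iff (two_ne_zero) |>.1 this
  have hm : M 1 1 0 = u / 2 := by
    have hw2 : w = 1 / 2 := Complex.ext (by rw [hre', h4]) (by rw [him]; norm_num)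
    have : u * w = M 1 1 0 := by rw [hwdef]; linear_combination M 1 1 0 * huu
    rw [← this, hw2]; ring
  have hone : (equatorialState e * M 1).trace =
      ((1 / 2 * (1 + (star e * u).re) : ℝ) : ℂ) := by
    rw [PrepareMeasure.trace_equatorialState_mul e (hM.1.1 1).isHermitian, hm]
    congr 1
    have : (star e * (u / 2)).re = (star e * u).re / 2 := by
      rw [← mul_div_assoc]; simp
    rw [this]; linarith
  rcases Int.units_eq_one_or b with rfl | rfl
  · simpa using hone
  · rw [hM.1.neg_one_eq, mul_sub, mul_one, trace_sub, hone]
    have : (equatorialState e).trace = 1 := by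
      simp [equatorialState, trace_fin_two]; norm_num
    rw [this]
    push_cast
    ring

end Helstrom

/-! ### The behaviour `P*` from Helstrom measurements. -/

section Qubit

variable {N : ℕ}

open Complex

lemma normSq_exp_ofReal_mul_I (t : ℝ) : normSq (exp (t * I)) = 1 := by
  rw [normSq_apply, exp_ofReal_mul_I_re, exp_ofReal_mul_I_im]
  nlinarith [Real.sin_sq_add_cos_sq t]

lemma qubitState_eq (x : Input N) : qubitState N x =
    equatorialState (exp ((2 * (Real.pi / N) * (x : ℕ) : ℝ) * I)) := by
  refine equatorialState_eq_vecMulVec (normSq_exp_ofReal_mul_I _) _ ?_ ?_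
  · simp [qubitVector]
  · simp only [qubitVector]
    push_cast
    have : ((((1 : Fin 2) : ℕ) : ℕ) : ℂ) = 1 := Nat.cast_one
    rw [this]
    congr 2
    ring

/-- The Bloch phase of the Helstrom measurement for the pair `p`. -/
noncomputable def helstromPhase (p : InputPair N) : ℂ :=
  ⟨Real.sin (Real.pi / N * ((p.1.1 : ℕ) + (p.1.2 : ℕ))),
    -Real.cos (Real.pi / N * ((p.1.1 : ℕ) + (p.1.2 : ℕ)))⟩

lemma normSq_helstromPhase (p : InputPair N) : normSq (helstromPhase p) = 1 := by
  rw [normSq_apply]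
  simp only [helstromPhase]
  nlinarith [Real.sin_sq_add_cos_sq (Real.pi / N * ((p.1.1 : ℕ) + (p.1.2 : ℕ)))]

lemma exp_sub_exp_eq_helstromPhase (p : InputPair N) :
    exp ((2 * (Real.pi / N) * (p.1.1 : ℕ) : ℝ) * I) -
      exp ((2 * (Real.pi / N) * (p.1.2 : ℕ) : ℝ) * I) =
      2 * (Real.sin (Real.pi / N * ((p.1.2 : ℕ) - (p.1.1 : ℕ))) : ℝ) * helstromPhase p := by
  set a : ℝ := ((p.1.1 : ℕ) : ℝ)
  set b : ℝ := ((p.1.2 : ℕ) : ℝ)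
  have e1 : (2 * (Real.pi / N) * a + 2 * (Real.pi / N) * b) / 2 = Real.pi / N * (a + b) := by ring
  have e2 : (2 * (Real.pi / N) * a - 2 * (Real.pi / N) * b) / 2 = -(Real.pi / N * (b - a)) := by
    ring
  apply Complex.ext
  · rw [sub_re, exp_ofReal_mul_I_re, exp_ofReal_mul_I_re, Real.cos_sub_cos, e1, e2, Real.sin_neg]
    simp only [helstromPhase, mul_re, re_ofNat, im_ofNat, ofReal_re, ofReal_im, mul_im]
    ring
  · rw [sub_im, exp_ofReal_mul_I_im, exp_ofReal_mul_I_im, Real.sin_sub_sin, e1, e2, Real.sin_neg]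
    simp only [helstromPhase, mul_re, re_ofNat, im_ofNat, ofReal_re, ofReal_im, mul_im]
    ring

/-- Since `0 < z - y < N`, the angle lies strictly between `0` and `π`; in particular the two states
are distinct. -/
lemma sin_pair_pos (p : InputPair N) :
    0 < Real.sin (Real.pi / N * ((p.1.2 : ℕ) - (p.1.1 : ℕ))) := by
  obtain ⟨⟨⟨y, hy⟩, ⟨z, hz⟩⟩, hyz⟩ := p
  replace hyz : y < z := hyz
  rw [mem_Icc] at hy hz
  have h1 : (y : ℝ) + 1 ≤ z := by exact_mod_cast hyz
  have h2 : (z : ℝ) ≤ N := by exact_mod_cast hz.2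
  have h3 : (1 : ℝ) ≤ y := by exact_mod_cast hy.1
  have hN : (0 : ℝ) < N := by linarith
  refine Real.sin_pos_of_pos_of_lt_pi (mul_pos (by positivity) (by simp; linarith)) ?_
  rw [div_mul_eq_mul_div, div_lt_iff₀ hN]
  refine mul_lt_mul_of_pos_left ?_ Real.pi_pos
  simp; linarith

lemma isState_qubitState (x : Input N) : IsState (qubitState N x) := by
  rw [qubitState_eq]; exact isState_equatorialState (normSq_exp_ofReal_mul_I _)

lemma isHelstrom_qubitState (p : InputPair N) :
    IsHelstrom (qubitState N p.1.1) (qubitState N p.1.2)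
      fun b : ℤˣ => equatorialState (((b : ℤ) : ℂ) * helstromPhase p) := by
  rw [qubitState_eq, qubitState_eq]
  exact isHelstrom_equatorialState (exp_sub_exp_eq_helstromPhase p) (sin_pair_pos p)
    (normSq_helstromPhase p)

lemma isBornBehaviour_qubitBehaviour {M : InputPair N → ℤˣ → Matrix (Fin 2) (Fin 2) ℂ}
    (hM : ∀ p, IsHelstrom (qubitState N p.1.1) (qubitState N p.1.2) (M p)) :
    IsBornBehaviour (qubitState N) M (qubitBehaviour N) := by
  intro x p b
  have h := hM p
  rw [qubitState_eq, qubitState_eq] at h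
  rw [qubitState_eq, h.trace_equatorialState_mul (exp_sub_exp_eq_helstromPhase p)
    (sin_pair_pos p) (normSq_helstromPhase p)]
  congr 1
  have : (star (exp ((2 * (Real.pi / N) * (x : ℕ) : ℝ) * I)) * helstromPhase p).re =
      -sinTerm N x p := by
    rw [sinTerm_eq, ← sub_eq_add_neg, Real.sin_sub, star_def, mul_re, conj_re, conj_im,
      exp_ofReal_mul_I_re, exp_ofReal_mul_I_im]
    simp only [helstromPhase]
    ring
  rw [this, qubitBehaviour]; ring

lemma qubitBehaviour_mem_quantumSet :
    qubitBehaviour N ∈ quantumSet (Input N) (InputPair N) ℤˣ 2 := by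
  refine subset_convexHull ℝ _ ⟨2, qubitState N, _, isState_qubitState, ?_,
    fun p => (isHelstrom_qubitState p).1, isBornBehaviour_qubitBehaviour isHelstrom_qubitState⟩
  exact (Submodule.finrank_le _).trans (by simp)

end Qubit

/-! ### The classical bound for even `N`, its attainment, and the gap. -/

section Classical

variable {N m : ℕ}

lemma pi_div_mul_self (hN : 2 ≤ N) : Real.pi / N * N = Real.pi := by
  have : (2 : ℝ) ≤ N := by exact_mod_cast hN
  field_simp

lemma sum_range_half_sin (hm : N = m + m) (hN : 2 ≤ N) (β : ℝ) :
    ∑ i ∈ range m, Real.sin (2 * (Real.pi / N) * i + β) =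
      Real.cos (β - Real.pi / N) / Real.sin (Real.pi / N) := by
  have hs := sin_pi_div_pos hN
  have h := two_mul_sin_mul_sum_sin (Real.pi / N) β m
  have e : 2 * (Real.pi / N) * m = Real.pi := by
    have h1 := pi_div_mul_self hN
    have h2 : (N : ℝ) = m + m := by exact_mod_cast hm
    linear_combination h1 - Real.pi / N * h2
  rw [e, Real.cos_add_pi] at h
  rw [eq_div_iff hs.ne']
  linarith

/-- Any set of inputs is dominated by a half period in a given direction. -/
lemma exists_sum_sin_le_half_period (hm : N = m + m) (hN : 2 ≤ N) (ω : ℝ) : ∃ j : ℤ,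
    ∀ S : Finset (Input N), ∑ x ∈ S, Real.sin (2 * (Real.pi / N) * (x : ℕ) - ω) ≤
      ∑ i ∈ range m, Real.sin (2 * (Real.pi / N) * (i + j) - ω) := by
  have hN0 : (2 : ℝ) ≤ N := by exact_mod_cast hN
  have hmN : (N : ℝ) = m + m := by exact_mod_cast hm
  have hθ : 0 < 2 * (Real.pi / N) := by positivity
  have hθN : 2 * (Real.pi / N) * N = 2 * Real.pi := by
    linear_combination 2 * pi_div_mul_self hN
  have hθm : 2 * (Real.pi / N) * m = Real.pi := by
    linear_combination 1 / 2 * hθN - Real.pi / N * hmN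
  -- `j` is the first sample point at or after the zero `ω` of the sinusoid; the `m` points from `j`
  -- on lie in its nonnegative half period.
  set j := ⌈ω / (2 * (Real.pi / N))⌉ with hj
  have hj1 : ω ≤ 2 * (Real.pi / N) * j := by
    have := Int.le_ceil (ω / (2 * (Real.pi / N)))
    rw [div_le_iff₀ hθ] at this
    linarith
  have hj2 : 2 * (Real.pi / N) * j < ω + 2 * (Real.pi / N) := by
    have := Int.ceil_lt_add_one (ω / (2 * (Real.pi / N)))
    rw [← hj, ← sub_lt_iff_lt_add, lt_div_iff₀ hθ] at this
    linarith
  refine ⟨j, fun S => ?_⟩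
  -- Any subset sum is at most the full-period sum of positive parts; a shift by `m` flips the sign
  -- of the sine, so only the chosen half period survives.
  set h : ℤ → ℝ := fun k => max 0 (Real.sin (2 * (Real.pi / N) * k - ω)) with hh
  have hper : ∀ k, h (k + N) = h k := by
    intro k
    simp only [hh]
    congr 1
    rw [← Real.sin_add_two_pi (2 * (Real.pi / N) * (k : ℝ) - ω)]
    congr 1
    push_cast
    linear_combination hθN
  have hnn : ∀ i ∈ range m, 0 ≤ Real.sin (2 * (Real.pi / N) * (i + j) - ω) := by
    intro i hi
    have hi' : (i : ℝ) + 1 ≤ m := by exact_mod_cast mem_range.1 hi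
    have hi0 : (0 : ℝ) ≤ i := by positivity
    refine Real.sin_nonneg_of_nonneg_of_le_pi ?_ ?_ <;> nlinarith
  calc ∑ x ∈ S, Real.sin (2 * (Real.pi / N) * (x : ℕ) - ω)
      ≤ ∑ x ∈ S, h ((x : ℕ) + (0 : ℤ)) := by
        refine sum_le_sum fun x _ => ?_
        simp [hh]
    _ ≤ ∑ x : Input N, h ((x : ℕ) + (0 : ℤ)) :=
        sum_le_sum_of_subset_of_nonneg (subset_univ S) fun x _ _ => le_max_left _ _
    _ = ∑ i ∈ range N, h (i + j) := by
        rw [sum_input_add_int hper, sum_range_add_int_of_periodic hper]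
    _ = ∑ i ∈ range m, h (i + j) + ∑ i ∈ range m, h ((m + i : ℕ) + j) := by
        rw [← sum_range_add (fun i : ℕ => h (i + j)), hm]
    _ = ∑ i ∈ range m, Real.sin (2 * (Real.pi / N) * (i + j) - ω) + 0 := by
        congr 1
        · refine sum_congr rfl fun i hi => ?_
          simp only [hh]
          push_cast
          exact max_eq_right (hnn i hi)
        · refine sum_eq_zero fun i hi => ?_
          simp only [hh]
          refine max_eq_left ?_
          have e : 2 * (Real.pi / N) * (((m + i : ℕ) + j : ℤ) : ℝ) - ω =
              2 * (Real.pi / N) * (i + j) - ω + Real.pi := by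
            push_cast
            linear_combination hθm
          rw [e, Real.sin_add_pi]
          linarith [hnn i hi]
    _ = _ := add_zero _

/-- Invariance of the pair sum under a joint cyclic shift. -/
lemma sum_pairs_shift {h : ℤ → ℝ} (hh : ∀ k, h (k + N) = h k) (c j : ℤ) :
    ∑ p : InputPair N, h ((p.1.1 : ℕ) + (p.1.2 : ℕ) + (c + 2 * j)) =
      ∑ p : InputPair N, h ((p.1.1 : ℕ) + (p.1.2 : ℕ) + c) := by
  -- The full square does not depend on `c`; the diagonal is invariant under `c ↦ c + 2 * j`, by a
  -- shift of `y` by `j`.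
  have key : ∀ c : ℤ, 2 * ∑ p : InputPair N, h ((p.1.1 : ℕ) + (p.1.2 : ℕ) + c) =
      N * ∑ i ∈ range N, h i - ∑ y : Input N, h ((y : ℕ) + (y : ℕ) + c) := by
    intro c
    rw [two_mul_sum_pairs (fun y z : Input N => h ((y : ℕ) + (z : ℕ) + c))
      (fun y z => by rw [add_comm ((y : ℕ) : ℤ)])]
    congr 1
    have : ∀ y : Input N, ∑ z : Input N, h ((y : ℕ) + (z : ℕ) + c) = ∑ i ∈ range N, h i := by
      intro y
      rw [← sum_input_add_int hh ((y : ℕ) + c)]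
      exact sum_congr rfl fun z _ => by congr 1; ring
    simp only [this, sum_const, card_univ, card_input, nsmul_eq_mul]
  have hper : ∀ k : ℤ, h (k + N + (k + N) + c) = h (k + k + c) := by
    intro k
    rw [← hh (k + k + c), ← hh (k + k + c + N)]
    congr 1; ring
  have d1 := sum_input_add_int (h := fun k => h (k + k + c)) hper j
  have d2 := sum_input_add_int (h := fun k => h (k + k + c)) hper 0
  have d3 : ∑ y : Input N, h ((y : ℕ) + (y : ℕ) + (c + 2 * j)) =
      ∑ y : Input N, h ((y : ℕ) + (y : ℕ) + c) := by
    rw [← d2] at d1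
    simp only [add_zero] at d1
    rw [← d1]
    exact sum_congr rfl fun y _ => by congr 1; ring
  have k1 := key c
  have k2 := key (c + 2 * j)
  rw [d3] at k2
  linarith

lemma sum_pairs_abs_cos_shift (hN : 2 ≤ N) (j : ℤ) :
    ∑ p : InputPair N,
        |Real.cos (Real.pi / N * ((p.1.1 : ℕ) + (p.1.2 : ℕ) + (1 + 2 * j)))| =
      ∑ p : InputPair N, |Real.cos (Real.pi / N * (1 + (p.1.1 : ℕ) + (p.1.2 : ℕ)))| := by
  have hper : ∀ k : ℤ, |Real.cos (Real.pi / N * ((k + N : ℤ) : ℝ))| =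
      |Real.cos (Real.pi / N * (k : ℝ))| := by
    intro k
    push_cast
    rw [mul_add, pi_div_mul_self hN, Real.cos_add_pi, abs_neg]
  have h := sum_pairs_shift (h := fun k => |Real.cos (Real.pi / N * (k : ℝ))|) hper 1 j
  push_cast at h
  rw [h]
  refine sum_congr rfl fun p _ => ?_
  congr 3; ring

/-- Among all sets of inputs, half periods maximize the total imbalance. -/
lemma sum_abs_sum_sinTerm_le (hm : N = m + m) (hN : 2 ≤ N) (S : Finset (Input N)) :
    ∑ p : InputPair N, |∑ x ∈ S, sinTerm N x p| ≤ 1 / Real.sin (Real.pi / N) *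
      ∑ p : InputPair N, |Real.cos (Real.pi / N * (1 + (p.1.1 : ℕ) + (p.1.2 : ℕ)))| := by
  have hs := sin_pi_div_pos hN
  set φ : InputPair N → ℝ := fun p => Real.pi / N * ((p.1.1 : ℕ) + (p.1.2 : ℕ)) with hφ
  have hε : ∀ p, ∃ e : ℝ, |e| ≤ 1 ∧ |∑ x ∈ S, sinTerm N x p| = e * ∑ x ∈ S, sinTerm N x p := by
    intro p
    rcases abs_cases (∑ x ∈ S, sinTerm N x p) with h | h
    · exact ⟨1, by simp, by rw [h.1]; ring⟩
    · exact ⟨-1, by simp, by rw [h.1]; ring⟩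
  choose ε hε1 hε2 using hε
  -- With the signs fixed, the sinusoids of all pairs add up to one of amplitude `‖z‖` and phase
  -- `z.arg`.
  set z : ℂ := ⟨∑ p, ε p * Real.cos (φ p), ∑ p, ε p * Real.sin (φ p)⟩ with hz
  have hre : ‖z‖ * Real.cos z.arg = ∑ p, ε p * Real.cos (φ p) := Complex.norm_mul_cos_arg z
  have him : ‖z‖ * Real.sin z.arg = ∑ p, ε p * Real.sin (φ p) := Complex.norm_mul_sin_arg z
  have hpolar : ∀ t : ℝ, ∑ p, ε p * Real.sin (t - φ p) = ‖z‖ * Real.sin (t - z.arg) := by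
    intro t
    have : ‖z‖ * Real.sin (t - z.arg) = Real.sin t * (‖z‖ * Real.cos z.arg) -
        Real.cos t * (‖z‖ * Real.sin z.arg) := by rw [Real.sin_sub]; ring
    rw [this, hre, him, mul_sum, mul_sum, ← sum_sub_distrib]
    exact sum_congr rfl fun p _ => by rw [Real.sin_sub]; ring
  obtain ⟨j, hj⟩ := exists_sum_sin_le_half_period hm hN z.arg
  calc ∑ p : InputPair N, |∑ x ∈ S, sinTerm N x p|
      = ∑ x ∈ S, ‖z‖ * Real.sin (2 * (Real.pi / N) * (x : ℕ) - z.arg) := by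
        simp only [hε2, mul_sum]
        rw [sum_comm]
        refine sum_congr rfl fun x _ => ?_
        rw [← hpolar]
        exact sum_congr rfl fun p _ => by rw [sinTerm_eq, sub_eq_add_neg]
    _ ≤ ‖z‖ * ∑ i ∈ range m, Real.sin (2 * (Real.pi / N) * (i + j) - z.arg) := by
        rw [← mul_sum]
        exact mul_le_mul_of_nonneg_left (hj S) (norm_nonneg z)
    _ = ∑ p, ε p * (Real.cos (2 * (Real.pi / N) * j - φ p - Real.pi / N) /
          Real.sin (Real.pi / N)) := by
        rw [mul_sum]
        simp only [← hpolar]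
        rw [sum_comm]
        refine sum_congr rfl fun p _ => ?_
        rw [← sum_range_half_sin hm hN, mul_sum]
        exact sum_congr rfl fun i _ => by congr 2; ring
    _ ≤ ∑ p : InputPair N, 1 / Real.sin (Real.pi / N) *
          |Real.cos (Real.pi / N * ((p.1.1 : ℕ) + (p.1.2 : ℕ) + (1 + 2 * (-j : ℤ))))| := by
        refine sum_le_sum fun p _ => ?_
        have e : Real.pi / N * ((p.1.1 : ℕ) + (p.1.2 : ℕ) + (1 + 2 * ((-j : ℤ) : ℝ))) =
            -(2 * (Real.pi / N) * j - φ p - Real.pi / N) := by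
          push_cast; simp only [hφ]; ring
        rw [e, Real.cos_neg]
        refine (le_abs_self _).trans ?_
        rw [abs_mul, abs_div, abs_of_pos hs, div_eq_mul_one_div, mul_comm (1 / _)]
        refine mul_le_of_le_one_left ?_ (hε1 p)
        positivity
    _ = _ := by rw [← mul_sum, sum_pairs_abs_cos_shift hN]

/-- The pairing of a deterministic two-message strategy with the witness. -/
lemma pairing_deterministic (hN : 2 ≤ N) {P : Input N → InputPair N → ℤˣ → ℝ}
    {f : Input N → Fin 2} {g : Fin 2 → InputPair N → ℤˣ}
    (hP : ∀ x y b, P x y b = if b = g (f x) y then 1 else 0) :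
    pairing P (witness N) = 2 / (N * √((N : ℝ) - 1)) *
      ((N : ℝ) ^ 2 * ((N : ℝ) - 1) / 4 +
        ∑ p, (((g 1 p : ℤ) : ℝ) - ((g 0 p : ℤ) : ℝ)) * ∑ x with f x = 0, sinTerm N x p) := by
  have hsgn : ∀ x p, P x p (-1) - P x p 1 = -((g (f x) p : ℤ) : ℝ) ∧ P x p 1 + P x p (-1) = 1 := by
    intro x p
    rw [hP, hP]
    rcases Int.units_eq_one_or (g (f x) p) with h | h <;> rw [h] <;> norm_num
  rw [pairing_witness_eq P fun x p => (hsgn x p).2]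
  congr 2
  refine sum_congr rfl fun p _ => ?_
  -- The answer to message 1 is taken as a baseline; its term vanishes in the sum over `x`.
  have h : ∀ x, sinTerm N x p * (P x p (-1) - P x p 1) = -((g 1 p : ℤ) : ℝ) * sinTerm N x p +
      (((g 1 p : ℤ) : ℝ) - ((g 0 p : ℤ) : ℝ)) * if f x = 0 then sinTerm N x p else 0 := by
    intro x
    rw [(hsgn x p).1]
    rcases Fin.exists_fin_two.1 ⟨f x, rfl⟩ with h | h <;> rw [h] <;> simp <;> ring
  simp only [h]
  rw [sum_add_distrib, ← mul_sum, ← mul_sum, sum_input_sinTerm hN, sum_filter]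
  ring

lemma boundC_eq : boundC N = 2 / (N * √((N : ℝ) - 1)) *
    ((N : ℝ) ^ 2 * ((N : ℝ) - 1) / 4 + 2 * (1 / Real.sin (Real.pi / N) *
      ∑ p : InputPair N, |Real.cos (Real.pi / N * (1 + (p.1.1 : ℕ) + (p.1.2 : ℕ)))|)) := by
  unfold boundC; congr 2; ring

theorem pairing_le_boundC (hN : 2 ≤ N) (hE : Even N) (P : Input N → InputPair N → ℤˣ → ℝ)
    (hP : P ∈ classicalSet (Input N) (InputPair N) ℤˣ 2) :
    pairing P (witness N) ≤ boundC N := by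
  obtain ⟨m, hm⟩ := hE
  refine convexHull_min ?_ (convex_setOf_pairing_le (witness N) (boundC N)) hP
  rintro P ⟨f, g, hP⟩
  change pairing P (witness N) ≤ boundC N
  rw [pairing_deterministic hN hP, boundC_eq]
  refine mul_le_mul_of_nonneg_left ?_ (pairing_prefactor_pos hN).le
  refine add_le_add_right ?_ _
  refine le_trans ?_ (mul_le_mul_of_nonneg_left
    (sum_abs_sum_sinTerm_le hm hN {x | f x = 0}) zero_le_two)
  rw [mul_sum]
  refine sum_le_sum fun p _ => (le_abs_self _).trans ?_
  rw [abs_mul]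
  refine mul_le_mul_of_nonneg_right ?_ (abs_nonneg _)
  rcases Int.units_eq_one_or (g 1 p) with h | h <;>
    rcases Int.units_eq_one_or (g 0 p) with h' | h' <;> rw [h, h'] <;> norm_num

/-- The input `N` plays the role of `0` modulo `N`, so the set is the half period `0, …, m - 1`. -/
lemma sum_sinTerm_half_period (hm : N = m + m) (hN : 2 ≤ N) (p : InputPair N) :
    ∑ x with ((x : Input N) : ℕ) < m ∨ (x : ℕ) = N, sinTerm N x p =
      Real.cos (Real.pi / N * (1 + (p.1.1 : ℕ) + (p.1.2 : ℕ))) / Real.sin (Real.pi / N) := by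
  set φ : ℝ := Real.pi / N * ((p.1.1 : ℕ) + (p.1.2 : ℕ)) with hφ
  set h : ℕ → ℝ := fun k => if k < m ∨ k = N then Real.sin (2 * (Real.pi / N) * k + -φ) else 0
    with hh
  have h1 : ∑ x with ((x : Input N) : ℕ) < m ∨ (x : ℕ) = N, sinTerm N x p =
      ∑ i ∈ range N, h (i + 1) := by
    rw [← sum_input_eq, sum_filter]
    refine sum_congr rfl fun x _ => ?_
    rw [sinTerm_eq]
  have h0N : h N = h 0 := by
    have e1 : h N = _ := if_pos (Or.inr rfl)
    have e2 : h 0 = _ := if_pos (Or.inl (by omega))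
    rw [e1, e2]
    rw [mul_assoc, pi_div_mul_self hN, add_comm, Real.sin_add_two_pi]
    simp
  have h2 := sum_range_succ' h N
  rw [sum_range_succ, h0N] at h2
  have h3 : ∑ i ∈ range N, h i = ∑ i ∈ range m, Real.sin (2 * (Real.pi / N) * i + -φ) := by
    rw [hm, sum_range_add, ← hm]
    rw [sum_congr rfl fun i hi => if_pos (Or.inl (mem_range.1 hi)), add_eq_left]
    refine sum_eq_zero fun i hi => if_neg ?_
    have := mem_range.1 hi
    omega
  rw [h1, ← add_right_cancel h2, h3, sum_range_half_sin hm hN, ← Real.cos_neg]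
  congr 2
  rw [hφ]; ring

theorem exists_deterministic_pairing_eq_boundC (hN : 2 ≤ N) (hE : Even N) :
    ∃ P ∈ deterministicBehaviours (Input N) (InputPair N) ℤˣ 2,
      pairing P (witness N) = boundC N := by
  obtain ⟨m, hm⟩ := hE
  let c : InputPair N → ℝ := fun p =>
    Real.cos (Real.pi / N * (1 + (p.1.1 : ℕ) + (p.1.2 : ℕ))) / Real.sin (Real.pi / N)
  let f : Input N → Fin 2 := fun x => if (x : ℕ) < m ∨ (x : ℕ) = N then 0 else 1
  -- Opposite answers to the two messages, with `g 1 - g 0` equal to twice the sign of `c p`.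
  let g : Fin 2 → InputPair N → ℤˣ := fun i p =>
    if i = 0 then (if 0 ≤ c p then -1 else 1) else (if 0 ≤ c p then 1 else -1)
  refine ⟨fun x p b => if b = g (f x) p then 1 else 0, ⟨f, g, fun _ _ _ => rfl⟩, ?_⟩
  rw [pairing_deterministic hN (f := f) (g := g) fun _ _ _ => rfl, boundC_eq]
  congr 2
  rw [mul_sum, mul_sum]
  refine sum_congr rfl fun p _ => ?_
  have hf : ∀ x : Input N, f x = 0 ↔ (x : ℕ) < m ∨ (x : ℕ) = N := by
    intro x
    by_cases h : (x : ℕ) < m ∨ (x : ℕ) = N <;> simp [f, h]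
  simp only [hf]
  rw [sum_sinTerm_half_period hm hN]
  change (((g 1 p : ℤ) : ℝ) - ((g 0 p : ℤ) : ℝ)) * c p = _
  have : 1 / Real.sin (Real.pi / N) *
      |Real.cos (Real.pi / N * (1 + (p.1.1 : ℕ) + (p.1.2 : ℕ)))| = |c p| := by
    rw [abs_div, abs_of_pos (sin_pi_div_pos hN)]; ring
  rw [this]
  by_cases h : 0 ≤ c p
  · simp [g, h, abs_of_nonneg h]
    left; norm_num
  · simp [g, h, abs_of_neg (not_le.1 h)]; ring

/-- Concave sine lies above its chord from `0` to `π / 4`. -/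
lemma le_sin_pi_div (hN : 4 ≤ N) : 2 * √2 / N ≤ Real.sin (Real.pi / N) := by
  have h4 : (4 : ℝ) ≤ N := by exact_mod_cast hN
  have hpi := Real.pi_pos
  have h0 : (0 : ℝ) ∈ Set.Icc 0 Real.pi := ⟨le_rfl, hpi.le⟩
  have h1 : Real.pi / 4 ∈ Set.Icc 0 Real.pi := ⟨by positivity, by linarith⟩
  have ha : (0 : ℝ) ≤ 1 - 4 / N := sub_nonneg.2 ((div_le_one (by linarith)).2 h4)
  have hb : (0 : ℝ) ≤ 4 / N := by positivity
  have h := strictConcaveOn_sin_Icc.concaveOn.2 h0 h1 ha hb (by ring)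
  simp only [smul_eq_mul, Real.sin_zero, mul_zero, zero_add, Real.sin_pi_div_four] at h
  have e : 4 / (N : ℝ) * (Real.pi / 4) = Real.pi / N := by ring
  rw [e] at h
  refine le_trans (le_of_eq ?_) h
  ring

lemma sum_pairs_abs_cos_lt (hN : 4 ≤ N) :
    √2 * ∑ p : InputPair N, |Real.cos (Real.pi / N * (1 + (p.1.1 : ℕ) + (p.1.2 : ℕ)))| <
      (N : ℝ) * (N - 1) / 2 := by
  set c : InputPair N → ℝ :=
    fun p => Real.cos (Real.pi / N * (1 + (p.1.1 : ℕ) + (p.1.2 : ℕ))) with hc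
  have h2 : √2 * √2 = 2 := Real.mul_self_sqrt (by norm_num)
  -- AM-GM, adapted to the mean value `1/2` of `c ^ 2` over pairs.
  have hle : ∀ p, √2 * |c p| ≤ c p ^ 2 + 1 / 2 := by
    intro p
    rw [← sq_abs (c p)]
    nlinarith [sq_nonneg (√2 * |c p| - 1)]
  -- The pair `(1, N - 2)` has `1 + y + z = N`, hence cosine `-1`, where the AM-GM step is strict;
  -- `N ≥ 4` makes it a valid pair.
  let p₀ : InputPair N := ⟨(⟨1, by simp; omega⟩, ⟨N - 2, by simp; omega⟩), by
    rw [← Subtype.coe_lt_coe]; change 1 < N - 2; omega⟩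
  have hp₀ : |c p₀| = 1 := by
    have : Real.pi / N * (1 + ((p₀.1.1 : ℕ) : ℝ) + ((p₀.1.2 : ℕ) : ℝ)) = Real.pi := by
      simp only [p₀]
      rw [Nat.cast_sub (by omega)]
      push_cast
      rw [← pi_div_mul_self (by omega : 2 ≤ N)]
      congr 1
      · rw [pi_div_mul_self (by omega : 2 ≤ N)]
      · ring
    simp only [hc]
    rw [this]; simp
  have hlt : √2 * |c p₀| < c p₀ ^ 2 + 1 / 2 := by
    rw [← sq_abs, hp₀]
    nlinarith [Real.sqrt_nonneg 2]
  have hsq : ∑ p, (c p ^ 2 + 1 / 2) = (N : ℝ) * (N - 1) / 2 := by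
    have : ∀ p, c p ^ 2 + 1 / 2 = 1 + 1 / 2 * Real.cos (2 * (Real.pi / N) *
        ((p.1.1 : ℕ) + (p.1.2 : ℕ)) + 2 * (Real.pi / N)) := by
      intro p
      have e : 2 * (Real.pi / N) * (((p.1.1 : ℕ) : ℝ) + ((p.1.2 : ℕ) : ℝ)) + 2 * (Real.pi / N) =
        2 * (Real.pi / N * (1 + (p.1.1 : ℕ) + (p.1.2 : ℕ))) := by ring
      rw [e, Real.cos_two_mul]
      simp only [hc]; ring
    simp only [this]
    rw [sum_add_distrib, ← mul_sum, sum_pairs_cos (by omega)]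
    simp only [sum_const, card_univ, nsmul_eq_mul]
    linear_combination 1 / 2 * two_mul_card_pairs N
  rw [mul_sum, ← hsq]
  exact sum_lt_sum (fun p _ => hle p) ⟨p₀, mem_univ _, hlt⟩

theorem boundC_lt_boundQ (hN : 4 ≤ N) : boundC N < boundQ N := by
  have h4 : (4 : ℝ) ≤ N := by exact_mod_cast hN
  rw [boundC_eq, boundQ_eq (by omega)]
  refine mul_lt_mul_of_pos_left ?_ (pairing_prefactor_pos (by omega))
  have h1 := sum_pairs_abs_cos_lt hN
  have h2 := le_sin_pi_div hN
  set C := ∑ p : InputPair N, |Real.cos (Real.pi / N * (1 + (p.1.1 : ℕ) + (p.1.2 : ℕ)))|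
  have hC : 0 ≤ C := sum_nonneg fun _ _ => abs_nonneg _
  have hq : √2 * √2 = 2 := Real.mul_self_sqrt (by norm_num)
  have hq0 : 0 < √2 := by positivity
  have hinv : 1 / Real.sin (Real.pi / N) ≤ N * √2 / 4 := by
    refine (one_div_le_one_div_of_le (by positivity) h2).trans (le_of_eq ?_)
    field_simp
    linarith
  have h3 : 1 / Real.sin (Real.pi / N) * C ≤ N * √2 / 4 * C :=
    mul_le_mul_of_nonneg_right hinv hC
  nlinarith

end Classical

end PrepareMeasure

theorem theorem5 (N : ℕ) (hN : 2 ≤ N) :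
    -- the quantum bound, and its attainment by the qubit behaviour
    (3 ≤ N →
      (∀ P ∈ PrepareMeasure.quantumSet (PrepareMeasure.Input N) (PrepareMeasure.InputPair N) ℤˣ 2,
        PrepareMeasure.pairing P (PrepareMeasure.witness N) ≤ PrepareMeasure.boundQ N) ∧
      PrepareMeasure.pairing (PrepareMeasure.qubitBehaviour N) (PrepareMeasure.witness N) =
        PrepareMeasure.boundQ N) ∧
    -- the qubit behaviour is quantum and arises from Helstrom measurements on the qubit states
    (PrepareMeasure.qubitBehaviour N ∈
        PrepareMeasure.quantumSet (PrepareMeasure.Input N) (PrepareMeasure.InputPair N) ℤˣ 2 ∧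
      (∀ x, PrepareMeasure.IsState (PrepareMeasure.qubitState N x)) ∧
      (∃ M : PrepareMeasure.InputPair N → ℤˣ → Matrix (Fin 2) (Fin 2) ℂ,
        ∀ p, PrepareMeasure.IsHelstrom (PrepareMeasure.qubitState N p.1.1)
          (PrepareMeasure.qubitState N p.1.2) (M p)) ∧
      ∀ M : PrepareMeasure.InputPair N → ℤˣ → Matrix (Fin 2) (Fin 2) ℂ,
        (∀ p, PrepareMeasure.IsHelstrom (PrepareMeasure.qubitState N p.1.1)
          (PrepareMeasure.qubitState N p.1.2) (M p)) →
        PrepareMeasure.IsBornBehaviour (PrepareMeasure.qubitState N) M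
          (PrepareMeasure.qubitBehaviour N)) ∧
    -- the classical bound for even `N`, attained by a deterministic behaviour
    (Even N →
      (∀ P ∈ PrepareMeasure.classicalSet (PrepareMeasure.Input N) (PrepareMeasure.InputPair N)
          ℤˣ 2,
        PrepareMeasure.pairing P (PrepareMeasure.witness N) ≤ PrepareMeasure.boundC N) ∧
      (∃ P ∈ PrepareMeasure.deterministicBehaviours (PrepareMeasure.Input N)
          (PrepareMeasure.InputPair N) ℤˣ 2,
        PrepareMeasure.pairing P (PrepareMeasure.witness N) = PrepareMeasure.boundC N) ∧
      (3 ≤ N → PrepareMeasure.boundC N < PrepareMeasure.boundQ N)) := by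
  refine ⟨fun h3 => ⟨PrepareMeasure.pairing_le_boundQ h3, PrepareMeasure.pairing_qubitBehaviour h3⟩,
    ⟨PrepareMeasure.qubitBehaviour_mem_quantumSet, PrepareMeasure.isState_qubitState,
      ⟨_, PrepareMeasure.isHelstrom_qubitState⟩,
      fun M hM => PrepareMeasure.isBornBehaviour_qubitBehaviour hM⟩,
    fun hE => ⟨PrepareMeasure.pairing_le_boundC hN hE,
      PrepareMeasure.exists_deterministic_pairing_eq_boundC hN hE, fun h3 => ?_⟩⟩
  -- An even `N ≥ 3` is at least 4.
  exact PrepareMeasure.boundC_lt_boundQ (by obtain ⟨m, hm⟩ := hE; omega)
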